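/- Let $n\ge 2$, $1\le i\le n-1$ and $\ell\ge 0$ be integers. For $N\ge 2$ let $\omega_k=\epsilon_1+\dots+\epsilon_k$ ($1\le k\le N-1$) be the fundamental weights of $\mathfrak{sl}_N(\mathbb C)$ with respect to the diagonal Cartan subalgebra and the Borel subalgebra of upper triangular matrices; those of $\mathfrak{sl}_{2n}$ are written $\tilde\omega_k$. Write $E_{p,q}$ for the elementary matrices, $x^{(m)}=x^m/m!$ for divided powers in the complex enveloping algebra, and $f_\alpha=E_{q,p}$ for a positive root $\alpha=\epsilon_p-\epsilon_q$ ($1\le p<q\le n$) of $\mathfrak{sl}_n$. *The ring.* Let $\mathfrak n^{-,a}\subset\mathfrak{sl}_{2n}$ be the abelian Lie algebra of block matrices $\begin{pmatrix}0&A\\0&0\end{pmatrix}$ with $A$ strictly lower triangular; its root vectors are $E_{\phi(\alpha)}:=E_{q,n+p}$ for $\alpha=\epsilon_p-\epsilon_q$, $p<q$. Let $S_{\mathbb Z}(\mathfrak n^{-,a})$ be its divided power algebra over $\mathbb Z$, i.e. the commutative ring generated by $X_\alpha^{(m)}$ ($\alpha$ a positive root of $\mathfrak{sl}_n$, $m\ge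 0$) with the relations $X_\alpha^{(0)}=1$ and $X_\alpha^{(a)}X_\alpha^{(b)}=\binom{a+b}{a}X_\alpha^{(a+b)}$. Let $\theta$ be the automorphism of $S_{\mathbb Z}(\mathfrak n^{-,a})$ with $\theta(X_{\epsilon_p-\epsilon_q}^{(m)})=(-1)^mX_{\epsilon_{n+1-q}-\epsilon_{n+1-p}}^{(m)}$; it is induced by the Chevalley involution $A\mapsto -A^T$ of $\mathfrak{sl}_n$ followed by conjugation with the permutation matrix of the longest Weyl group element. *The Demazure module.* Let $\Psi(\sum_k a_k\omega_k)=\sum_k a_k\tilde\omega_{2k}$, so $\Psi(\ell\omega_i)=\ell\tilde\omega_{2i}$, and let $\tau\in S_{2n}$ be given by $\tau(2k)=n+k$, $\tau(2k-1)=k$ for $1\le k\le n$. Let $\tilde V$ be the irreducible $\mathfrak{sl}_{2n}(\mathbb C)$-module with highest weight $\Psi(\ell\omega_i)$, $\tilde v$ a highest weight vector, $\check\tau$ any representative of $\tau$ in the Chevalley group $SL_{2n}(\mathbb Z)$ (generated on $\tilde V$ by the $\exp(tE_{p,q})$, $p\neq q$, $t\in\mathbb Z$), and $v_\tau=\check\tau\tilde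 v$. Let $U_{\mathbb Z}(\tilde{\mathfrak b})$ be the subring of $U(\mathfrak{sl}_{2n})$ generated by all $E_{p,q}^{(m)}$ with $p<q$ and all $\binom{H_j}{m}$, $H_j=E_{j,j}-E_{j+1,j+1}$. The Demazure module is $\tilde V_{\mathbb Z}(\Psi(\ell\omega_i))_\tau=U_{\mathbb Z}(\tilde{\mathfrak b})v_\tau$; on it $X_\alpha^{(m)}$ acts as $E_{\phi(\alpha)}^{(m)}$. *The abelianized module.* Let $V$ be the irreducible $\mathfrak{sl}_n(\mathbb C)$-module with highest weight $\ell\omega_{n-i}$ and $v$ a highest weight vector. For $s\ge -1$ let $V_s\subset V$ be the $\mathbb Z$-span of all $f_{\beta_1}^{(m_1)}\cdots f_{\beta_k}^{(m_k)}v$ with $m_1+\dots+m_k\le s$, and put $V^a_{\mathbb Z}(\ell\omega_{n-i})=\bigoplus_{s\ge 0}V_s/V_{s-1}$, an $S_{\mathbb Z}(\mathfrak n^{-,a})$-module on which $X_\alpha^{(m)}$ acts by the maps $V_s/V_{s-1}\to V_{s+m}/V_{s+m-1}$ induced by $f_\alpha^{(m)}$. **Proposition.** There is an isomorphism of $S_{\mathbb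 Z}(\mathfrak n^{-,a})$-modules $$\tilde V_{\mathbb Z}(\Psi(\ell\omega_i))_\tau\;\simeq\;V^a_{\mathbb Z}(\ell\omega_{n-i}),$$ where $S_{\mathbb Z}(\mathfrak n^{-,a})$ acts on the right-hand side through $\theta$; that is, there is an isomorphism of abelian groups $\Phi$ with $\Phi(s\cdot x)=\theta(s)\cdot\Phi(x)$ for all $s\in S_{\mathbb Z}(\mathfrak n^{-,a})$ and $x$. -/

import Mathlib

open scoped Nat

noncomputable section

namespace AbelianizedDemazure

/-! ### Divided powers in an algebra of characteristic zero -/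

section DividedPowers

variable {A : Type*} [Ring A] [Algebra ℂ A]

/-- The divided power `x ^ m / m!`. -/
def divPow (x : A) (m : ℕ) : A := ((m ! : ℂ))⁻¹ • x ^ m

/-- The binomial element `h (h - 1) ⋯ (h - m + 1) / m!`. -/
def binomElt (h : A) (m : ℕ) : A := ((m ! : ℂ))⁻¹ • Polynomial.aeval h (descPochhammer ℂ m)

theorem divPow_zero (x : A) : divPow x 0 = 1 := by simp [divPow]

theorem divPow_one (x : A) : divPow x 1 = x := by simp [divPow]

theorem divPow_mul (x : A) (a b : ℕ) :
    divPow x a * divPow x b = ((a + b).choose a : ℕ) • divPow x (a + b) := by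
  have ha : (a ! : ℂ) ≠ 0 := by exact_mod_cast a.factorial_ne_zero
  have hb : (b ! : ℂ) ≠ 0 := by exact_mod_cast b.factorial_ne_zero
  have hab : ((a + b) ! : ℂ) ≠ 0 := by exact_mod_cast (a + b).factorial_ne_zero
  have h : ((a + b).choose a : ℂ) * (a ! : ℂ) * (b ! : ℂ) = ((a + b) ! : ℂ) := by
    have := Nat.choose_mul_factorial_mul_factorial (Nat.le_add_right a b)
    rw [Nat.add_sub_cancel_left] at this
    exact_mod_cast this
  have h2 : (a ! : ℂ)⁻¹ * (b ! : ℂ)⁻¹ = ((a + b).choose a : ℂ) * ((a + b) ! : ℂ)⁻¹ := by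
    rw [← h]
    have hc : ((a + b).choose a : ℂ) ≠ 0 := by
      exact_mod_cast (Nat.choose_pos (Nat.le_add_right a b)).ne'
    field_simp
  rw [← Nat.cast_smul_eq_nsmul ℂ]
  simp only [divPow]
  rw [smul_mul_smul_comm, ← pow_add, smul_smul, h2]

theorem divPow_commute {x y : A} (h : Commute x y) (a b : ℕ) :
    Commute (divPow x a) (divPow y b) :=
  ((h.pow_pow a b).smul_left _).smul_right _

theorem succ_smul_divPow (x : A) (m : ℕ) : ((m : ℂ) + 1) • divPow x (m + 1) = x * divPow x m := by
  have h := divPow_mul x 1 m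
  rw [divPow_one, Nat.choose_one_right, ← Nat.cast_smul_eq_nsmul ℂ] at h
  rw [h, add_comm 1 m]
  push_cast
  rfl

/-- `x y^{(m+1)} = y^{(m+1)} x + y^{(m)} [x, y]` if `[x, y]` is central. -/
theorem mul_divPow_succ {x y z : A} (h : x * y = y * x + z) (hy : Commute y z) (m : ℕ) :
    x * divPow y (m + 1) = divPow y (m + 1) * x + divPow y m * z := by
  have hpow : ∀ m : ℕ, x * y ^ (m + 1) = y ^ (m + 1) * x + ((m : ℂ) + 1) • (y ^ m * z) := by
    intro m
    induction m with
    | zero => simp [h]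
    | succ m ih =>
      rw [pow_succ, ← mul_assoc, ih, add_mul, mul_assoc, h, mul_add, smul_mul_assoc, mul_assoc _ z y,
        ← hy.eq, ← mul_assoc (y ^ m), ← pow_succ, ← mul_assoc, ← pow_succ]
      push_cast
      module
  have hm : ((m + 1) ! : ℂ)⁻¹ * ((m : ℂ) + 1) = (m ! : ℂ)⁻¹ := by
    have h1 : (m ! : ℂ) ≠ 0 := by exact_mod_cast m.factorial_ne_zero
    have h2 : (m : ℂ) + 1 ≠ 0 := by exact_mod_cast m.succ_ne_zero
    rw [Nat.factorial_succ]
    push_cast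
    field_simp
  simp only [divPow, mul_smul_comm, smul_mul_assoc]
  rw [hpow, smul_add, smul_smul, hm]

/-- The general term of the reordering formula for `x^{(a)} y^{(b)}`. -/
def reorderTerm (x y z : A) (a b k : ℕ) : A :=
  if k ≤ a ∧ k ≤ b then divPow y (b - k) * divPow x (a - k) * divPow z k else 0

/-- If `[x, y] = z` commutes with `x` and `y`, then
`x^{(a)} y^{(b)} = ∑ₖ y^{(b-k)} x^{(a-k)} z^{(k)}`. -/
theorem divPow_reorder {x y z : A} (h : x * y = y * x + z) (hx : Commute x z) (hy : Commute y z)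
    (a b : ℕ) :
    divPow x a * divPow y b = ∑ k ∈ Finset.range (a + 1), reorderTerm x y z a b k := by
  induction a with
  | zero => simp [reorderTerm, divPow_zero]
  | succ a ih =>
    have key : ∀ k, k ≤ a → x * reorderTerm x y z a b k =
        ((a : ℂ) + 1 - k) • reorderTerm x y z (a + 1) b k +
          ((k : ℂ) + 1) • reorderTerm x y z (a + 1) b (k + 1) := by
      intro k hk
      obtain ⟨c, rfl⟩ := Nat.exists_eq_add_of_le hk
      by_cases hb : k ≤ b
      · obtain ⟨d, rfl⟩ := Nat.exists_eq_add_of_le hb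
        have e1 : reorderTerm x y z (k + c) (k + d) k =
            divPow y d * divPow x c * divPow z k := by
          simp [reorderTerm]
        have e2 : reorderTerm x y z (k + c + 1) (k + d) k =
            divPow y d * divPow x (c + 1) * divPow z k := by
          rw [reorderTerm, if_pos ⟨by omega, by omega⟩]
          congr 3 <;> omega
        have hc : (((k + c : ℕ) : ℂ) + 1 - k) = (c : ℂ) + 1 := by push_cast; ring
        have hxc : x * divPow x c = ((c : ℂ) + 1) • divPow x (c + 1) := (succ_smul_divPow x c).symm
        rw [e1, e2, hc]
        cases d with
        | zero =>
          have e3 : reorderTerm x y z (k + c + 1) (k + 0) (k + 1) = 0 := by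
            rw [reorderTerm, if_neg (by omega)]
          rw [e3, divPow_zero, one_mul, one_mul, smul_zero, add_zero, ← mul_assoc, hxc,
            smul_mul_assoc]
        | succ d =>
          have e3 : reorderTerm x y z (k + c + 1) (k + (d + 1)) (k + 1) =
              divPow y d * divPow x c * divPow z (k + 1) := by
            rw [reorderTerm, if_pos ⟨by omega, by omega⟩]
            congr 3 <;> omega
          have hzx : z * divPow x c = divPow x c * z := by
            have := divPow_commute hx.symm 1 c
            rw [divPow_one] at this
            exact this.eq
          rw [e3, ← mul_assoc, ← mul_assoc, mul_divPow_succ h hy, add_mul, add_mul, mul_assoc _ x,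
            hxc, mul_assoc _ z, hzx, mul_smul_comm, smul_mul_assoc, ← mul_assoc (divPow y d),
            mul_assoc _ z, ← succ_smul_divPow, mul_smul_comm]
      · rw [reorderTerm, if_neg (by omega), reorderTerm, if_neg (by omega), reorderTerm,
          if_neg (by omega)]
        simp
    have hne : ((a : ℂ) + 1) ≠ 0 := by exact_mod_cast a.succ_ne_zero
    have hsum : ((a : ℂ) + 1) • (divPow x (a + 1) * divPow y b) =
        ((a : ℂ) + 1) • ∑ k ∈ Finset.range (a + 1 + 1), reorderTerm x y z (a + 1) b k := by
      rw [← smul_mul_assoc, succ_smul_divPow, mul_assoc, ih, Finset.mul_sum,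
        Finset.sum_congr rfl (fun k hk => key k (by simpa [Nat.lt_succ_iff] using hk)),
        Finset.sum_add_distrib]
      have s1 : ∑ k ∈ Finset.range (a + 1),
          ((a : ℂ) + 1 - k) • reorderTerm x y z (a + 1) b k =
          ∑ k ∈ Finset.range (a + 1 + 1),
            ((a : ℂ) + 1 - k) • reorderTerm x y z (a + 1) b k := by
        rw [Finset.sum_range_succ _ (a + 1)]
        simp
      have s2 : ∑ k ∈ Finset.range (a + 1),
          ((k : ℂ) + 1) • reorderTerm x y z (a + 1) b (k + 1) =
          ∑ k ∈ Finset.range (a + 1 + 1), (k : ℂ) • reorderTerm x y z (a + 1) b k := by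
        rw [Finset.sum_range_succ' _ (a + 1)]
        simp
      rw [s1, s2, ← Finset.sum_add_distrib, Finset.smul_sum]
      refine Finset.sum_congr rfl fun k _ => ?_
      rw [← add_smul]
      congr 1
      ring
    have := congrArg (fun t => ((a : ℂ) + 1)⁻¹ • t) hsum
    simpa [smul_smul, inv_mul_cancel₀ hne] using this

end DividedPowers

/-! ### The Lie algebra `𝔰𝔩_N`, its weights and its hyperalgebras -/

/-- The complex Lie algebra `𝔰𝔩_N`. -/
abbrev SlN (N : ℕ) := LieAlgebra.SpecialLinear.sl (Fin N) ℂ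

/-- The complex enveloping algebra `U(𝔰𝔩_N)`. -/
abbrev UN (N : ℕ) := UniversalEnvelopingAlgebra ℂ (SlN N)

/-- The elementary matrix `E_{p,q}`, `p ≠ q`: a root vector for the root `ε_p - ε_q`. -/
def elemMat {N : ℕ} (p q : Fin N) (h : p ≠ q) : SlN N :=
  LieAlgebra.SpecialLinear.single p q h (1 : ℂ)

/-- The root vector `E_{p,q}` as an element of the enveloping algebra. -/
def rootVec {N : ℕ} (p q : Fin N) (h : p ≠ q) : UN N :=
  UniversalEnvelopingAlgebra.ι ℂ (elemMat p q h)

/-- The simple coroot `H_j = E_{j,j} - E_{j+1,j+1}` in the enveloping algebra. -/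
def simpleCoroot {N : ℕ} (j : ℕ) (h : j + 1 < N) : UN N :=
  UniversalEnvelopingAlgebra.ι ℂ
    (LieAlgebra.SpecialLinear.singleSubSingle (⟨j, by omega⟩ : Fin N) ⟨j + 1, h⟩ (1 : ℂ))

/-- The hyperalgebra `U_ℤ(𝔟)` of the Borel subalgebra of upper triangular matrices: the subring of
the enveloping algebra generated by the divided powers of the positive root vectors and the
binomial elements of the simple coroots. -/
def hyperBorel (N : ℕ) : Subalgebra ℤ (UN N) :=
  Algebra.adjoin ℤ
    ({x | ∃ (p q : Fin N) (h : p < q) (m : ℕ), x = divPow (rootVec p q h.ne) m} ∪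
      {x | ∃ (j : ℕ) (h : j + 1 < N) (m : ℕ), x = binomElt (simpleCoroot j h) m})

/-- Integral weights of `𝔰𝔩_N`: `a` stands for `∑ a_k ω_k`, the sum over `0 < k < N`. -/
abbrev IntWeight (N : ℕ) := Set.Ioo 0 N → ℤ

/-- The value of the weight `∑ a_k ω_k` at the diagonal matrix with (traceless) diagonal `d`, where
`ω_k = ε_1 + ⋯ + ε_k`. -/
def weightVal {N : ℕ} (a : IntWeight N) (d : Fin N → ℂ) : ℂ :=
  ∑ k : Set.Ioo 0 N, (a k : ℂ) * ∑ t : Fin N, if (t : ℕ) < k then d t else 0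

/-- The map `Ψ(∑ a_k ω_k) = ∑ a_k ω̃_{2k}` from weights of `𝔰𝔩_n` to weights of `𝔰𝔩_{2n}`. -/
def Psi {n : ℕ} (a : IntWeight n) : IntWeight (2 * n) :=
  ∑ k : Set.Ioo 0 n,
    Pi.single ⟨2 * (k : ℕ), by have := k.2.1; omega, by have := k.2.2; omega⟩ (a k)

/-- The index `n - k` of the fundamental weight dual to `ω_k`. -/
def dualIndex {n : ℕ} (k : Set.Ioo 0 n) : Set.Ioo 0 n :=
  ⟨n - k, by have := k.2.2; omega, by have := k.2.1; have := k.2.2; omega⟩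

/-! ### Representations -/

section Representations

variable {N : ℕ} {V : Type*} [AddCommGroup V] [Module ℂ V] [LieRingModule (SlN N) V]
  [LieModule ℂ (SlN N) V]

/-- `v` is a highest weight vector of weight `μ`. -/
structure IsHighestWeightVector (μ : IntWeight N) (v : V) : Prop where
  ne_zero : v ≠ 0
  raising : ∀ (p q : Fin N) (h : p < q), ⁅elemMat p q h.ne, v⁆ = 0
  weight : ∀ (d : Fin N → ℂ) (x : SlN N), (x : Matrix (Fin N) (Fin N) ℂ) = Matrix.diagonal d →
    ⁅x, v⁆ = weightVal μ d • v

variable (V) in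
/-- The action of the enveloping algebra. -/
def uAct : UN N →ₐ[ℂ] Module.End ℂ V :=
  UniversalEnvelopingAlgebra.lift ℂ (LieModule.toEnd ℂ (SlN N) V)

/-- The map `u ↦ u v`. -/
def orbitMap (v : V) : UN N →ₗ[ℤ] V where
  toFun u := uAct V u v
  map_add' x y := by simp
  map_smul' c x := by simp

variable (N V) in
/-- The image in `GL(V)` of the simply connected Chevalley group `SL_N(ℤ)`: it is generated by the
`exp (t E_{p,q})`, `t ∈ ℤ`. -/
def chevalleyGroup : Subgroup (Module.End ℂ V)ˣ :=
  Subgroup.closure {u | ∃ (p q : Fin N) (h : p ≠ q) (t : ℤ) (k : ℕ),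
    LieModule.toEnd ℂ (SlN N) V (elemMat p q h) ^ k = 0 ∧
    (u : Module.End ℂ V) = ∑ m ∈ Finset.range k,
      ((t : ℂ) ^ m) • divPow (LieModule.toEnd ℂ (SlN N) V (elemMat p q h)) m}

/-- `g` is the operator on `V` of a representative, in the Chevalley group, of the Weyl group element
`w`: it lies in the Chevalley group and conjugates the Cartan subalgebra into itself by `w`. -/
structure IsWeylRepresentative (w : Equiv.Perm (Fin N)) (g : (Module.End ℂ V)ˣ) : Prop where
  mem : g ∈ chevalleyGroup N V
  conj : ∀ (d : Fin N → ℂ) (x y : SlN N),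
    (x : Matrix (Fin N) (Fin N) ℂ) = Matrix.diagonal d →
    (y : Matrix (Fin N) (Fin N) ℂ) = Matrix.diagonal (fun t => d (w.symm t)) →
    (g : Module.End ℂ V) * LieModule.toEnd ℂ (SlN N) V x =
      LieModule.toEnd ℂ (SlN N) V y * (g : Module.End ℂ V)

variable (N) in
/-- The Demazure module `U_ℤ(𝔟) v_w`, where `v_w = g v` for a highest weight vector `v` and a
representative `g` of the Weyl group element `w`. -/
def demazure (g : (Module.End ℂ V)ˣ) (v : V) : Submodule ℤ V :=
  (Subalgebra.toSubmodule (hyperBorel N)).map (orbitMap (N := N) ((g : Module.End ℂ V) v))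

theorem orbitMap_mul (u u' : UN N) (v : V) : orbitMap v (u * u') = uAct V u (orbitMap v u') := by
  simp [orbitMap]

theorem demazure_stable (g : (Module.End ℂ V)ˣ) (v : V) {u : UN N} (hu : u ∈ hyperBorel N)
    {x : V} (hx : x ∈ demazure N g v) : uAct V u x ∈ demazure N g v := by
  obtain ⟨u', hu', rfl⟩ := hx
  exact ⟨u * u', (hyperBorel N).mul_mem hu hu', orbitMap_mul u u' _⟩

end Representations

/-- The Weyl group element `τ ∈ S_{2n}`: in one-based numbering `τ(2k) = n + k` and
`τ(2k - 1) = k` for `k = 1, …, n`. -/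
def tau (n : ℕ) : Equiv.Perm (Fin (2 * n)) where
  toFun t := if (t : ℕ) % 2 = 0 then ⟨t / 2, by omega⟩ else ⟨n + t / 2, by omega⟩
  invFun t := if h : (t : ℕ) < n then ⟨2 * t, by omega⟩ else ⟨2 * (t - n) + 1, by omega⟩
  left_inv t := by grind
  right_inv t := by grind

/-! ### The ring `S_ℤ(𝔫^{-,a})` -/

/-- The positive roots `ε_i - ε_j`, `i < j`, of `𝔰𝔩_n`. -/
abbrev PosRoot (n : ℕ) := {r : Fin n × Fin n // r.1 < r.2}

/-- The relations between the divided powers `X_α^{(m)}` of commuting variables. -/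
inductive SymRel (n : ℕ) :
    FreeAlgebra ℤ (PosRoot n × ℕ) → FreeAlgebra ℤ (PosRoot n × ℕ) → Prop
  | zero (α : PosRoot n) : SymRel n (FreeAlgebra.ι ℤ (α, 0)) 1
  | mul (α : PosRoot n) (a b : ℕ) :
      SymRel n (FreeAlgebra.ι ℤ (α, a) * FreeAlgebra.ι ℤ (α, b))
        ((a + b).choose a • FreeAlgebra.ι ℤ (α, a + b))
  | comm (α β : PosRoot n) (a b : ℕ) :
      SymRel n (FreeAlgebra.ι ℤ (α, a) * FreeAlgebra.ι ℤ (β, b))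
        (FreeAlgebra.ι ℤ (β, b) * FreeAlgebra.ι ℤ (α, a))

/-- The ring `S_ℤ(𝔫^{-,a})`: the commutative divided power algebra over `ℤ` on the abelian Lie
algebra with basis the root vectors `X_α`, `α` a positive root. It is the hyperalgebra of `𝔫^{-,a}`
(where `X_α` is `E_{φ(α)}`) and the associated graded ring of `U_ℤ(𝔫^-)` (where `X_α` is the class
of `f_α`). -/
def SymZ (n : ℕ) : Type := RingQuot (SymRel n)

instance (n : ℕ) : Ring (SymZ n) := inferInstanceAs (Ring (RingQuot (SymRel n)))

/-- The divided power `X_α^{(m)}` in `S_ℤ(𝔫^{-,a})`. -/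
def SymZ.gen {n : ℕ} (α : PosRoot n) (m : ℕ) : SymZ n :=
  RingQuot.mkRingHom (SymRel n) (FreeAlgebra.ι ℤ (α, m))

theorem SymZ.gen_zero {n : ℕ} (α : PosRoot n) : SymZ.gen α 0 = 1 :=
  (RingQuot.mkRingHom_rel (SymRel.zero α)).trans (map_one _)

theorem SymZ.gen_mul {n : ℕ} (α : PosRoot n) (a b : ℕ) :
    SymZ.gen α a * SymZ.gen α b = (a + b).choose a • SymZ.gen α (a + b) := by
  have h := RingQuot.mkRingHom_rel (SymRel.mul α a b)
  rw [map_mul, map_nsmul] at h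
  exact h

theorem SymZ.gen_comm {n : ℕ} (α β : PosRoot n) (a b : ℕ) :
    SymZ.gen α a * SymZ.gen β b = SymZ.gen β b * SymZ.gen α a := by
  have h := RingQuot.mkRingHom_rel (SymRel.comm α β a b)
  rw [map_mul, map_mul] at h
  exact h

/-- Elements of a ring that satisfy the relations of the `X_α^{(m)}` define a ring homomorphism. -/
def SymZ.lift {n : ℕ} {B : Type*} [Ring B] (P : PosRoot n → ℕ → B) (h0 : ∀ α, P α 0 = 1)
    (hmul : ∀ α a b, P α a * P α b = (a + b).choose a • P α (a + b))
    (hcomm : ∀ α β a b, P α a * P β b = P β b * P α a) : SymZ n →+* B :=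
  RingQuot.lift ⟨((FreeAlgebra.lift ℤ fun x : PosRoot n × ℕ => P x.1 x.2 :
      FreeAlgebra ℤ (PosRoot n × ℕ) →ₐ[ℤ] B) : FreeAlgebra ℤ (PosRoot n × ℕ) →+* B), by
    intro x y h
    cases h with
    | zero α => simp [h0]
    | mul α a b => simp [hmul]
    | comm α β a b => simp [hcomm α β a b]⟩

theorem SymZ.lift_gen {n : ℕ} {B : Type*} [Ring B] (P : PosRoot n → ℕ → B) (h0 : ∀ α, P α 0 = 1)
    (hmul : ∀ α a b, P α a * P α b = (a + b).choose a • P α (a + b))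
    (hcomm : ∀ α β a b, P α a * P β b = P β b * P α a) (α : PosRoot n) (m : ℕ) :
    SymZ.lift P h0 hmul hcomm (SymZ.gen α m) = P α m := by
  unfold SymZ.lift SymZ.gen
  erw [RingQuot.lift_mkRingHom_apply]
  simp

theorem SymZ.hom_ext {n : ℕ} {B : Type*} [Ring B] {f g : SymZ n →+* B}
    (h : ∀ α m, f (SymZ.gen α m) = g (SymZ.gen α m)) : f = g := by
  refine RingQuot.ringQuot_ext (r := SymRel n) f g ?_
  have : ((f.comp (RingQuot.mkRingHom (SymRel n))).toIntAlgHom :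
      FreeAlgebra ℤ (PosRoot n × ℕ) →ₐ[ℤ] B) =
      (g.comp (RingQuot.mkRingHom (SymRel n))).toIntAlgHom := by
    apply FreeAlgebra.hom_ext
    funext x
    exact h x.1 x.2
  ext x
  exact DFunLike.congr_fun this x

/-- The permutation `ε_i - ε_j ↦ ε_{n+1-j} - ε_{n+1-i}` of the positive roots (one-based
numbering): the automorphism `-w₀`. -/
def dualRoot {n : ℕ} (α : PosRoot n) : PosRoot n :=
  ⟨(Fin.rev α.1.2, Fin.rev α.1.1), Fin.rev_lt_rev.2 α.2⟩

/-- The automorphism of `S_ℤ(𝔫^{-,a})` induced by the automorphism `A ↦ -w₀ Aᵀ w₀⁻¹` of `𝔫^-`, the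
Chevalley involution `A ↦ -Aᵀ` followed by conjugation with the permutation matrix of the longest
element `w₀`. It sends `X_α^{(m)}` to `(-X_{-w₀ α})^{(m)}`. -/
def chevalleyTwist (n : ℕ) : SymZ n →+* SymZ n :=
  SymZ.lift (fun α m => (-1) ^ m * SymZ.gen (dualRoot α) m)
    (fun α => by simp [SymZ.gen_zero])
    (fun α a b => by
      rw [((Commute.neg_one_right (SymZ.gen (dualRoot α) a)).pow_right b).mul_mul_mul_comm, ← pow_add,
        SymZ.gen_mul, mul_smul_comm])
    (fun α β a b => by
      rw [((Commute.neg_one_right (SymZ.gen (dualRoot α) a)).pow_right b).mul_mul_mul_comm,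
        ((Commute.neg_one_right (SymZ.gen (dualRoot β) b)).pow_right a).mul_mul_mul_comm,
        SymZ.gen_comm, ← pow_add, ← pow_add, add_comm])

theorem chevalleyTwist_gen {n : ℕ} (α : PosRoot n) (m : ℕ) :
    chevalleyTwist n (SymZ.gen α m) = (-1) ^ m * SymZ.gen (dualRoot α) m :=
  SymZ.lift_gen _ _ _ _ α m

theorem chevalleyTwist_comp (n : ℕ) :
    (chevalleyTwist n).comp (chevalleyTwist n) = RingHom.id (SymZ n) := by
  refine SymZ.hom_ext fun α m => ?_
  have h : dualRoot (dualRoot α) = α := by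
    apply Subtype.ext
    simp [dualRoot]
  rw [RingHom.comp_apply, chevalleyTwist_gen, map_mul, chevalleyTwist_gen, h, map_pow, map_neg,
    map_one, ← mul_assoc, ← pow_add, Even.neg_one_pow ⟨m, rfl⟩, one_mul, RingHom.id_apply]

instance (n : ℕ) : RingHomInvPair (chevalleyTwist n) (chevalleyTwist n) where
  comp_eq := chevalleyTwist_comp n
  comp_eq₂ := chevalleyTwist_comp n

/-! ### The Demazure module as an `S_ℤ(𝔫^{-,a})`-module -/

/-- The root vector `E_{φ(α)} ∈ 𝔫^{-,a} ⊆ 𝔰𝔩_{2n}`: for `α = ε_i - ε_j` it is `E_{j, n+i}`, the image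
of the lower triangular matrix `f_α = E_{j,i}` in the upper right block. -/
def abelVec {n : ℕ} (α : PosRoot n) : UN (2 * n) :=
  rootVec ⟨α.1.2, by omega⟩ ⟨n + α.1.1, by omega⟩ (by simp [Fin.ext_iff]; omega)

theorem lie_elemMat {N : ℕ} {p q r s : Fin N} (h : p ≠ q) (h' : r ≠ s) (h1 : q ≠ r) (h2 : s ≠ p) :
    ⁅elemMat p q h, elemMat r s h'⁆ = 0 := by
  apply Subtype.ext
  rw [LieAlgebra.SpecialLinear.sl_bracket]
  simp [elemMat, h1, h2]

theorem lie_elemMat' {N : ℕ} {p q s : Fin N} (h : p ≠ q) (h' : q ≠ s) (h2 : p ≠ s) :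
    ⁅elemMat p q h, elemMat q s h'⁆ = elemMat p s h2 := by
  apply Subtype.ext
  rw [LieAlgebra.SpecialLinear.sl_bracket]
  simp [elemMat, h2.symm]

attribute [local instance 100] LieRing.ofAssociativeRing

theorem rootVec_commute {N : ℕ} {p q r s : Fin N} (h : p ≠ q) (h' : r ≠ s) (h1 : q ≠ r)
    (h2 : s ≠ p) : Commute (rootVec p q h) (rootVec r s h') := by
  rw [commute_iff_lie_eq, rootVec, rootVec, ← LieHom.map_lie, lie_elemMat h h' h1 h2, map_zero]

theorem rootVec_mul {N : ℕ} {p q s : Fin N} (h : p ≠ q) (h' : q ≠ s) (h2 : p ≠ s) :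
    rootVec p q h * rootVec q s h' = rootVec q s h' * rootVec p q h + rootVec p s h2 := by
  rw [← sub_eq_iff_eq_add', ← LieRing.of_associative_ring_bracket, rootVec, rootVec,
    ← LieHom.map_lie, lie_elemMat' h h' h2, rootVec]

theorem abelVec_commute {n : ℕ} (α β : PosRoot n) : Commute (abelVec α) (abelVec β) := by
  apply rootVec_commute
  · simp [Fin.ext_iff]; omega
  · simp [Fin.ext_iff]; omega

theorem abelVec_mem {n : ℕ} (α : PosRoot n) (m : ℕ) : divPow (abelVec α) m ∈ hyperBorel (2 * n) :=
  Algebra.subset_adjoin (Or.inl ⟨_, _, by simp [Fin.lt_def]; omega, m, rfl⟩)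

section DemazureModule

variable {n : ℕ} {V : Type*} [AddCommGroup V] [Module ℂ V] [LieRingModule (SlN (2 * n)) V]
  [LieModule ℂ (SlN (2 * n)) V]

/-- The operator of `E_{φ(α)}^{(m)}` on a Demazure module. -/
def demazureOp (g : (Module.End ℂ V)ˣ) (v : V) (α : PosRoot n) (m : ℕ) :
    Module.End ℤ (demazure (2 * n) g v) where
  toFun x := ⟨uAct V (divPow (abelVec α) m) x, demazure_stable g v (abelVec_mem α m) x.2⟩
  map_add' x y := by ext; simp
  map_smul' c x := by ext; simp

/-- The ring homomorphism `S_ℤ(𝔫^{-,a}) → End` with `X_α^{(m)} ↦ E_{φ(α)}^{(m)}`. -/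
def demazureAct (g : (Module.End ℂ V)ˣ) (v : V) :
    SymZ n →+* Module.End ℤ (demazure (2 * n) g v) :=
  SymZ.lift (demazureOp g v)
    (fun α => by ext x; simp [demazureOp, divPow_zero])
    (fun α a b => by
      ext x
      have := congrArg (fun u => uAct V u (x : V)) (divPow_mul (abelVec α) a b)
      simpa [demazureOp] using this)
    (fun α β a b => by
      ext x
      have := congrArg (fun u => uAct V u (x : V)) (divPow_commute (abelVec_commute α β) a b).eq
      simpa [demazureOp] using this)

instance (g : (Module.End ℂ V)ˣ) (v : V) : Module (SymZ n) (demazure (2 * n) g v) :=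
  Module.compHom _ (demazureAct g v)

theorem gen_smul_demazure (g : (Module.End ℂ V)ˣ) (v : V) (α : PosRoot n) (m : ℕ)
    (x : demazure (2 * n) g v) :
    ((SymZ.gen α m • x : demazure (2 * n) g v) : V) = uAct V (divPow (abelVec α) m) x := by
  change ((demazureAct g v (SymZ.gen α m) x : demazure (2 * n) g v) : V) = _
  rw [demazureAct, SymZ.lift_gen]
  rfl

end DemazureModule

/-! ### The PBW filtration and the abelianized module -/

/-- The root vector `f_α = E_{j,i} ∈ 𝔫^-` for `α = ε_i - ε_j`. -/
def lowVec {n : ℕ} (α : PosRoot n) : UN n := rootVec α.1.2 α.1.1 α.2.ne'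

/-- The product `f_{β₁}^{(m₁)} ⋯ f_{βₖ}^{(mₖ)}`. -/
def lowWord {n : ℕ} (l : List (PosRoot n × ℕ)) : UN n :=
  (l.map fun r => divPow (lowVec r.1) r.2).prod

/-- The total degree `m₁ + ⋯ + mₖ`. -/
def wordDeg {n : ℕ} (l : List (PosRoot n × ℕ)) : ℕ := (l.map Prod.snd).sum

/-- The PBW filtration of the hyperalgebra `U_ℤ(𝔫^-)`: the `ℤ`-span of the products of divided
powers of total degree at most `d` (zero for `d < 0`). -/
def pbw (n : ℕ) (d : ℤ) : Submodule ℤ (UN n) :=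
  Submodule.span ℤ {x | ∃ l : List (PosRoot n × ℕ), (wordDeg l : ℤ) ≤ d ∧ x = lowWord l}

theorem pbw_mono {n : ℕ} {d e : ℤ} (h : d ≤ e) : pbw n d ≤ pbw n e :=
  Submodule.span_mono fun _ ⟨l, hl, hx⟩ => ⟨l, hl.trans h, hx⟩

theorem pbw_mul {n : ℕ} {d e : ℤ} {x y : UN n} (hx : x ∈ pbw n d) (hy : y ∈ pbw n e) :
    x * y ∈ pbw n (d + e) := by
  have h : pbw n d * pbw n e ≤ pbw n (d + e) := by
    rw [pbw, pbw, Submodule.span_mul_span]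
    apply Submodule.span_le.2
    rintro _ ⟨_, ⟨l, hl, rfl⟩, _, ⟨l', hl', rfl⟩, rfl⟩
    refine Submodule.subset_span ⟨l ++ l', ?_, by simp [lowWord]⟩
    simp only [wordDeg, List.map_append, List.sum_append, Nat.cast_add] at *
    exact add_le_add hl hl'
  exact h (Submodule.mul_mem_mul hx hy)

theorem divPow_mem_pbw {n : ℕ} (α : PosRoot n) (m : ℕ) : divPow (lowVec α) m ∈ pbw n m :=
  Submodule.subset_span ⟨[(α, m)], by simp [wordDeg], by simp [lowWord]⟩

/-- Reordering when `[f_α, f_β]` is the root vector `f_γ`. -/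
theorem comm_mem_pbw_aux {n : ℕ} {α β γ : PosRoot n}
    (h : lowVec α * lowVec β = lowVec β * lowVec α + lowVec γ)
    (h1 : Commute (lowVec α) (lowVec γ)) (h2 : Commute (lowVec β) (lowVec γ)) (a b : ℕ) :
    divPow (lowVec α) a * divPow (lowVec β) b - divPow (lowVec β) b * divPow (lowVec α) a ∈
      pbw n ((a : ℤ) + b - 1) := by
  rw [divPow_reorder h h1 h2, Finset.sum_range_succ']
  have h0 : reorderTerm (lowVec α) (lowVec β) (lowVec γ) a b 0 =
      divPow (lowVec β) b * divPow (lowVec α) a := by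
    simp [reorderTerm, divPow_zero]
  rw [h0, add_sub_cancel_right]
  refine Submodule.sum_mem _ fun k _ => ?_
  rw [reorderTerm]
  split_ifs with hk
  · refine pbw_mono ?_ (pbw_mul (pbw_mul (divPow_mem_pbw β (b - (k + 1)))
      (divPow_mem_pbw α (a - (k + 1)))) (divPow_mem_pbw γ (k + 1)))
    omega
  · exact Submodule.zero_mem _

/-- Divided powers of root vectors commute up to terms of lower PBW degree. -/
theorem comm_mem_pbw {n : ℕ} (α β : PosRoot n) (a b : ℕ) :
    divPow (lowVec α) a * divPow (lowVec β) b - divPow (lowVec β) b * divPow (lowVec α) a ∈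
      pbw n ((a : ℤ) + b - 1) := by
  obtain ⟨⟨i, j⟩, hij⟩ := α
  obtain ⟨⟨k, l⟩, hkl⟩ := β
  simp only at hij hkl
  by_cases h1 : i = l
  · subst h1
    refine comm_mem_pbw_aux (γ := ⟨(k, j), hkl.trans hij⟩) ?_ ?_ ?_ a b
    · exact rootVec_mul hij.ne' hkl.ne' (hkl.trans hij).ne'
    · exact rootVec_commute _ _ hij.ne (hkl.trans hij).ne
    · exact rootVec_commute _ _ (hkl.trans hij).ne hkl.ne
  · by_cases h2 : k = j
    · subst h2
      have := comm_mem_pbw_aux (α := ⟨(k, l), hkl⟩) (β := ⟨(i, k), hij⟩)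
        (γ := ⟨(i, l), hij.trans hkl⟩) (rootVec_mul hkl.ne' hij.ne' (hij.trans hkl).ne')
        (rootVec_commute _ _ hkl.ne (hij.trans hkl).ne)
        (rootVec_commute _ _ (hij.trans hkl).ne hij.ne) b a
      have h3 := Submodule.neg_mem _ this
      rw [neg_sub, add_comm (b : ℤ)] at h3
      exact h3
    · have h3 : Commute (lowVec ⟨(i, j), hij⟩) (lowVec ⟨(k, l), hkl⟩) :=
        rootVec_commute _ _ h1 h2
      rw [(divPow_commute h3 a b).eq, sub_self]
      exact Submodule.zero_mem _

section Abelianized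

variable {n : ℕ} {V : Type*} [AddCommGroup V] [Module ℂ V] [LieRingModule (SlN n) V]
  [LieModule ℂ (SlN n) V]

variable (n) in
/-- The induced PBW filtration `U_ℤ(𝔫^-)_d v` of the `ℤ`-form `V_ℤ = U_ℤ(𝔰𝔩_n) v = U_ℤ(𝔫^-) v`
generated by a highest weight vector `v`. -/
def pbwFilt (v : V) (d : ℤ) : Submodule ℤ V := (pbw n d).map (orbitMap (N := n) v)

variable (n) in
/-- The homogeneous component `V_s / V_{s-1}` of the associated graded module. -/
abbrev grPiece (v : V) (s : ℕ) :=
  pbwFilt n v s ⧸ (pbwFilt n v ((s : ℤ) - 1)).submoduleOf (pbwFilt n v s)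

variable (n) in
/-- The abelianized module `V^a_ℤ`: the associated graded group of the PBW filtration. -/
def Abelianized (v : V) : Type _ := DirectSum ℕ (grPiece n v)

instance (v : V) : AddCommGroup (Abelianized n v) :=
  inferInstanceAs (AddCommGroup (DirectSum ℕ (grPiece n v)))

theorem act_mem_pbwFilt {v x : V} {u : UN n} {d e : ℤ} (hu : u ∈ pbw n d)
    (hx : x ∈ pbwFilt n v e) : uAct V u x ∈ pbwFilt n v (d + e) := by
  obtain ⟨u', hu', rfl⟩ := hx
  exact ⟨u * u', pbw_mul hu hu', orbitMap_mul u u' v⟩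

theorem pbwFilt_mono {v : V} {d e : ℤ} (h : d ≤ e) : pbwFilt n v d ≤ pbwFilt n v e :=
  Submodule.map_mono (pbw_mono h)

theorem low_mem (v : V) (α : PosRoot n) (m s : ℕ) {x : V} (hx : x ∈ pbwFilt n v s) :
    uAct V (divPow (lowVec α) m) x ∈ pbwFilt n v ((s + m : ℕ) : ℤ) :=
  pbwFilt_mono (by push_cast; omega) (act_mem_pbwFilt (divPow_mem_pbw α m) hx)

theorem low_mem' (v : V) (α : PosRoot n) (m s : ℕ) {x : V}
    (hx : x ∈ pbwFilt n v ((s : ℤ) - 1)) :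
    uAct V (divPow (lowVec α) m) x ∈ pbwFilt n v (((s + m : ℕ) : ℤ) - 1) :=
  pbwFilt_mono (by push_cast; omega) (act_mem_pbwFilt (divPow_mem_pbw α m) hx)

/-- The map `V_s → V_{s+m}` given by `f_α^{(m)}`. -/
def lowMap (v : V) (α : PosRoot n) (m s : ℕ) :
    pbwFilt n v s →ₗ[ℤ] pbwFilt n v ((s + m : ℕ) : ℤ) where
  toFun x := ⟨uAct V (divPow (lowVec α) m) x, low_mem v α m s x.2⟩
  map_add' x y := by ext; simp
  map_smul' c x := by ext; simp

/-- The map `V_s / V_{s-1} → V_{s+m} / V_{s+m-1}` induced by `f_α^{(m)}`. -/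
def grMap (v : V) (α : PosRoot n) (m s : ℕ) : grPiece n v s →ₗ[ℤ] grPiece n v (s + m) :=
  Submodule.mapQ _ _ (lowMap v α m s) (fun _ hx => low_mem' v α m s hx)

/-- The operator of `X_α^{(m)}` on the abelianized module, induced by `f_α^{(m)}`. -/
def abelOp (v : V) (α : PosRoot n) (m : ℕ) : Module.End ℤ (Abelianized n v) :=
  DirectSum.toModule ℤ ℕ (DirectSum ℕ (grPiece n v))
    (fun s => (DirectSum.lof ℤ ℕ (grPiece n v) (s + m)).comp (grMap v α m s))

/-- The class of `x ∈ V_s` in degree `s` of the associated graded module. -/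
def grClass (v : V) (s : ℕ) (x : V) (hx : x ∈ pbwFilt n v s) : Abelianized n v :=
  DirectSum.lof ℤ ℕ (grPiece n v) s (Submodule.Quotient.mk ⟨x, hx⟩)

theorem abelOp_grClass (v : V) (α : PosRoot n) (m s : ℕ) (x : V) (hx : x ∈ pbwFilt n v s) :
    abelOp v α m (grClass v s x hx) =
      grClass v (s + m) (uAct V (divPow (lowVec α) m) x) (low_mem v α m s hx) := by
  unfold abelOp grClass
  erw [DirectSum.toModule_lof]
  rfl

theorem grClass_congr {v : V} {s t : ℕ} (h : s = t) {x y : V} (hx : x ∈ pbwFilt n v s)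
    (hy : y ∈ pbwFilt n v t) (hxy : x - y ∈ pbwFilt n v ((t : ℤ) - 1)) :
    grClass v s x hx = grClass v t y hy := by
  subst h
  unfold grClass
  congr 1
  exact (Submodule.Quotient.eq _).2 hxy

theorem end_ext {v : V} {f g : Module.End ℤ (Abelianized n v)}
    (h : ∀ s x hx, f (grClass v s x hx) = g (grClass v s x hx)) : f = g := by
  refine DirectSum.linearMap_ext (R := ℤ) fun s => ?_
  refine Submodule.linearMap_qext _ ?_
  ext x
  exact h s x x.2

theorem nsmul_grClass {v : V} (c s : ℕ) (x : V) (hx : x ∈ pbwFilt n v s) :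
    c • grClass v s x hx = grClass v s (c • x) (nsmul_mem hx c) := by
  exact (map_nsmul (DirectSum.lof ℤ ℕ (grPiece n v) s) c (Submodule.Quotient.mk ⟨x, hx⟩)).symm

/-- The ring homomorphism `S_ℤ(𝔫^{-,a}) → End` where `X_α^{(m)}` acts by the class of `f_α^{(m)}`. -/
def abelAct (v : V) : SymZ n →+* Module.End ℤ (Abelianized n v) :=
  SymZ.lift (abelOp v)
    (fun α => end_ext fun s x hx => by
      rw [abelOp_grClass]
      refine grClass_congr (by simp) _ _ ?_
      simp [divPow_zero])
    (fun α a b => end_ext fun s x hx => by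
      rw [Module.End.mul_apply, abelOp_grClass, abelOp_grClass, LinearMap.smul_apply,
        abelOp_grClass, nsmul_grClass]
      refine grClass_congr (by omega) _ _ ?_
      have := congrArg (fun u => uAct V u x) (divPow_mul (lowVec α) a b)
      simp only [map_mul, map_nsmul, Module.End.mul_apply, LinearMap.smul_apply] at this
      rw [this, sub_self]
      exact Submodule.zero_mem _)
    (fun α β a b => end_ext fun s x hx => by
      rw [Module.End.mul_apply, Module.End.mul_apply, abelOp_grClass, abelOp_grClass,
        abelOp_grClass, abelOp_grClass]
      refine grClass_congr (by omega) _ _ ?_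
      have := act_mem_pbwFilt (comm_mem_pbw α β a b) hx
      simp only [map_sub, map_mul, Module.End.mul_apply, LinearMap.sub_apply] at this
      exact pbwFilt_mono (by push_cast; omega) this)

instance (v : V) : Module (SymZ n) (Abelianized n v) := Module.compHom _ (abelAct v)

theorem gen_smul_grClass (v : V) (α : PosRoot n) (m s : ℕ) (x : V) (hx : x ∈ pbwFilt n v s) :
    SymZ.gen α m • grClass v s x hx =
      grClass v (s + m) (uAct V (divPow (lowVec α) m) x) (low_mem v α m s hx) := by
  rw [← abelOp_grClass]
  change abelAct v (SymZ.gen α m) _ = _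
  rw [abelAct, SymZ.lift_gen]

end Abelianized

end AbelianizedDemazure

end

open AbelianizedDemazure

/-!
The permutation `τ` carries the highest weight line of the `𝔰𝔩_{2n}`-module to an extremal line
for a copy of `𝔤𝔩_n` inside `𝔤𝔩_{2n}`: the vector `v_τ` has weight `ℓ ∑_{s < i} ε_s` for this
copy, whose operators `E_{t,s}` with `s < i ≤ t` are root vectors `E_{φ(α)}`, and every other
`E_{φ(α)}` annihilates the Demazure module. On the other side, twisting the action of `𝔰𝔩_n` by
the Chevalley involution, the longest Weyl group element and a multiple of the trace turns `v`
into an extremal vector of the same weight. The operators `E_{t,s}` commute with each other, and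
both modules are direct sums over `d` of the lattices spanned by their divided power monomials of
degree `d` applied to the extremal vector.

It remains to match these lattices. In either representation no nonzero vector of positive degree
is killed by all raising operators `E_{s,t}`, by irreducibility. Hence the `𝔤𝔩_n`-submodule of the
direct sum of the two representations generated by the pair of extremal vectors meets both
summands trivially, that is, it is the graph of a bijection; this bijection commutes with the
lowering operators and therefore identifies the lattices degree by degree.
-/

noncomputable section

namespace AbelianizedDemazure

/-! ### Families of matrix units -/

section MatrixUnits

variable {I E : Type*} [DecidableEq I] [Ring E]

/-- The elements `A a b` of a ring satisfy the commutation relations of the matrix units `E_{a,b}`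
of `𝔤𝔩_I`. -/
def IsGlRep (A : I → I → E) : Prop :=
  ∀ a b c d, A a b * A c d - A c d * A a b =
    (if b = c then A a d else 0) - (if d = a then A c b else 0)

/-- The matrix units with a multiple of the trace added: `E_{a,b}` is replaced by
`E_{a,b} + c δ_{a,b}`. -/
def traceShift {R : Type*} [CommRing R] [Algebra R E] (A : I → I → E) (c : R) (a b : I) : E :=
  A a b + if a = b then algebraMap R E c else 0

/-- The family dual to `A`, with the indices permuted by `r`: `E_{a,b}` is replaced by
`-E_{r b, r a}`. -/
def contragredient (A : I → I → E) (r : Equiv.Perm I) (a b : I) : E :=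
  -A (r b) (r a)

variable {A : I → I → E}

theorem IsGlRep.commute (hA : IsGlRep A) {a b c d : I} (hbc : b ≠ c) (hda : d ≠ a) :
    Commute (A a b) (A c d) := by
  have h := hA a b c d
  rwa [if_neg hbc, if_neg hda, sub_zero, sub_eq_zero] at h

theorem IsGlRep.diag_mul (hA : IsGlRep A) (p a b : I) :
    A p p * A a b =
      A a b * A p p + ((if a = p then 1 else 0) - (if b = p then 1 else 0) : ℤ) • A a b := by
  rw [← sub_eq_iff_eq_add', hA p p a b, sub_smul]
  congr 1
  · rcases eq_or_ne a p with rfl | h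
    · simp
    · simp [h, h.symm]
  · by_cases h : b = p <;> simp [h]

theorem IsGlRep.map {F : Type*} [Ring F] (hA : IsGlRep A) (f : E →+* F) :
    IsGlRep fun a b => f (A a b) := by
  intro a b c d
  simpa only [map_sub, map_mul, apply_ite f, map_zero] using congrArg f (hA a b c d)

theorem IsGlRep.prodMk {F : Type*} [Ring F] {B : I → I → F} (hA : IsGlRep A) (hB : IsGlRep B) :
    IsGlRep fun a b => (A a b, B a b) := by
  intro a b c d
  refine Prod.ext ((hA a b c d).trans ?_) ((hB a b c d).trans ?_) <;>
    split_ifs <;> rfl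

theorem IsGlRep.reindex {J : Type*} [DecidableEq J] (hA : IsGlRep A) {j : J → I}
    (hj : Function.Injective j) : IsGlRep fun a b => A (j a) (j b) := by
  intro a b c d
  simp only [hA (j a) (j b) (j c) (j d), hj.eq_iff]

protected theorem IsGlRep.traceShift {R : Type*} [CommRing R] [Algebra R E] (hA : IsGlRep A)
    (c : R) : IsGlRep (traceShift A c) := by
  have shift_central (p q : I) (z : E) :
      (if p = q then algebraMap R E c else 0) * z = z * if p = q then algebraMap R E c else 0 := by
    split_ifs
    · exact Algebra.commutes c z
    · rw [zero_mul, mul_zero]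
  intro p q s t
  have commutator_eq :
      traceShift A c p q * traceShift A c s t - traceShift A c s t * traceShift A c p q =
        A p q * A s t - A s t * A p q := by
    simp only [traceShift, add_mul, mul_add, shift_central p q]
    rw [shift_central s t (A p q)]
    abel
  rw [commutator_eq, hA p q s t]
  unfold traceShift
  rcases eq_or_ne q s with rfl | hqs <;> rcases eq_or_ne t p with rfl | htp <;>
    simp [*, Ne.symm]

protected theorem IsGlRep.contragredient (hA : IsGlRep A) (r : Equiv.Perm I) :
    IsGlRep (contragredient A r) := by
  intro a b c d
  have h := hA (r b) (r a) (r d) (r c)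
  simp only [r.injective.eq_iff] at h
  simp only [contragredient, neg_mul_neg, h, @eq_comm _ d a, @eq_comm _ c b]
  split_ifs <;> simp [add_comm, sub_eq_add_neg]

end MatrixUnits

/-! ### Levels and raising operators -/

section Levels

variable {R I X Y : Type*} [CommRing R] [AddCommGroup X] [Module R X] [AddCommGroup Y] [Module R Y]

/-- There are no proper nonzero subspaces stable under all `A a b`. -/
def IsSimpleFamily (A : I → I → Module.End R X) : Prop :=
  ∀ U : Submodule R X, (∀ a b, U ≤ U.comap (A a b)) → U = ⊥ ∨ U = ⊤

/-- The submodule `N` is stable under the Levi subalgebra `𝔤𝔩_S × 𝔤𝔩_{I ∖ S}`. -/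
def IsLeviStable (A : I → I → Module.End R X) (S : Finset I) (N : Submodule R X) : Prop :=
  ∀ a b, (a ∈ S ↔ b ∈ S) → N ≤ N.comap (A a b)

/-- The vectors annihilated by all raising operators `A s t`, `s ∈ S`, `t ∉ S`. -/
def raisingKernel (A : I → I → Module.End R X) (S : Finset I) : Submodule R X :=
  ⨅ s ∈ S, ⨅ t ∉ S, LinearMap.ker (A s t)

/-- The span of the products of `d` lowering operators `A t s`, `s ∈ S`, `t ∉ S`, applied to `N`. -/
def level (A : I → I → Module.End R X) (S : Finset I) (N : Submodule R X) : ℕ → Submodule R X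
  | 0 => N
  | d + 1 => ⨆ s ∈ S, ⨆ t ∉ S, (level A S N d).map (A t s)

/-- The vector `x` spans a line stable under the parabolic subalgebra of the `E_{a,b}` with
`b ∈ S → a ∈ S`, on which the diagonal acts by the weight `ℓ ∑_{s ∈ S} ε_s`. -/
structure IsExtremal [DecidableEq I] (A : I → I → Module.End R X) (S : Finset I) (ℓ : R) (x : X) :
    Prop where
  ne_zero : x ≠ 0
  apply_eq_zero : ∀ a b, a ≠ b → (b ∈ S → a ∈ S) → A a b x = 0
  apply_diag : ∀ a, A a a x = (if a ∈ S then ℓ else 0) • x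

variable {A : I → I → Module.End R X} {B : I → I → Module.End R Y} {S : Finset I}
  {N : Submodule R X} {s t : I}

theorem mem_raisingKernel {z : X} :
    z ∈ raisingKernel A S ↔ ∀ s ∈ S, ∀ t ∉ S, A s t z = 0 := by
  simp only [raisingKernel, Submodule.mem_iInf, LinearMap.mem_ker]

theorem level_succ_le_iff {d : ℕ} {P : Submodule R X} :
    level A S N (d + 1) ≤ P ↔ ∀ s ∈ S, ∀ t ∉ S, ∀ z ∈ level A S N d, A t s z ∈ P := by
  simp only [level, iSup_le_iff, Submodule.map_le_iff_le_comap]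
  rfl

theorem lower_mem_level (hs : s ∈ S) (ht : t ∉ S) {d : ℕ} {z : X} (hz : z ∈ level A S N d) :
    A t s z ∈ level A S N (d + 1) :=
  level_succ_le_iff.1 le_rfl s hs t ht z hz

theorem map_level {f : X →ₗ[R] Y} (hf : ∀ a b, f ∘ₗ A a b = B a b ∘ₗ f) (d : ℕ) :
    (level A S N d).map f = level B S (N.map f) d := by
  induction d with
  | zero => rfl
  | succ d ih => simp only [level, Submodule.map_iSup, ← ih, ← Submodule.map_comp, hf]

protected theorem IsSimpleFamily.contragredient (hA : IsSimpleFamily A) (r : Equiv.Perm I) :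
    IsSimpleFamily (contragredient A r) := by
  refine fun U hU => hA U fun a b z hz => ?_
  have h := Submodule.mem_comap.1 (hU (r.symm b) (r.symm a) hz)
  rw [Submodule.mem_comap]
  simpa only [contragredient, Equiv.apply_symm_apply, LinearMap.neg_apply,
    neg_mem_iff] using h

variable [DecidableEq I]

theorem IsGlRep.apply (hA : IsGlRep A) (a b c d : I) (z : X) :
    A a b (A c d z) =
      A c d (A a b z) + ((if b = c then A a d z else 0) - if d = a then A c b z else 0) := by
  have h := DFunLike.congr_fun (hA a b c d) z
  rw [LinearMap.sub_apply, Module.End.mul_apply, Module.End.mul_apply, sub_eq_iff_eq_add'] at h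
  rw [h]
  split_ifs <;> rfl

theorem IsGlRep.apply_apply_mem (hA : IsGlRep A) {P : Submodule R X} {a b c d : I} {z : X}
    (h : A c d (A a b z) ∈ P) (hbc : b = c → A a d z ∈ P) (hda : d = a → A c b z ∈ P) :
    A a b (A c d z) ∈ P := by
  rw [hA.apply]
  refine add_mem h (sub_mem ?_ ?_)
  · split_ifs with hb
    exacts [hbc hb, zero_mem P]
  · split_ifs with hd
    exacts [hda hd, zero_mem P]

protected theorem IsLeviStable.level (hN : IsLeviStable A S N) (hA : IsGlRep A) (d : ℕ) :
    IsLeviStable A S (level A S N d) := by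
  induction d with
  | zero => exact hN
  | succ d ih =>
    intro a b hab
    refine level_succ_le_iff.2 fun s hs t ht z hz =>
      Submodule.mem_comap.2 (hA.apply_apply_mem ?_ ?_ ?_)
    · exact lower_mem_level hs ht (ih a b hab hz)
    · rintro rfl
      exact lower_mem_level hs (hab.not.2 ht) hz
    · rintro rfl
      exact lower_mem_level (hab.1 hs) ht hz

theorem isLeviStable_raisingKernel (hA : IsGlRep A) : IsLeviStable A S (raisingKernel A S) := by
  intro a b hab z hz
  refine mem_raisingKernel.2 fun s hs t ht => ?_
  rw [mem_raisingKernel] at hz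
  rw [← Submodule.mem_bot R]
  refine hA.apply_apply_mem ?_ ?_ ?_
  · rw [hz s hs t ht, map_zero]
    exact zero_mem _
  · rintro rfl
    exact (Submodule.mem_bot R).2 (hz s hs b (hab.not.1 ht))
  · rintro rfl
    exact (Submodule.mem_bot R).2 (hz a (hab.2 hs) t ht)

theorem IsLeviStable.raise_lower_mem_level (hN : IsLeviStable A S N) (hA : IsGlRep A)
    {s' t' : I} {d : ℕ} {z : X} (hs : s ∈ S) (ht : t ∉ S) (hs' : s' ∈ S) (ht' : t' ∉ S)
    (hz : z ∈ level A S N d)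
    (h : A t' s' (A s t z) ∈ level A S N d) :
    A s t (A t' s' z) ∈ level A S N d :=
  hA.apply_apply_mem h (fun _ => hN.level hA d s s' (iff_of_true hs hs') hz)
    fun _ => hN.level hA d t' t (iff_of_false ht' ht) hz

theorem IsLeviStable.raise_mem_level (hN : IsLeviStable A S N) (hA : IsGlRep A)
    (hN' : N ≤ raisingKernel A S) (hs : s ∈ S) (ht : t ∉ S) (d : ℕ) :
    level A S N (d + 1) ≤
      (level A S N d).comap (A s t) := by
  induction d with
  | zero =>
    refine level_succ_le_iff.2 fun s' hs' t' ht' z hz => ?_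
    refine hN.raise_lower_mem_level hA hs ht hs' ht' hz ?_
    rw [mem_raisingKernel.1 (hN' hz) s hs t ht, map_zero]
    exact zero_mem _
  | succ d ih =>
    refine level_succ_le_iff.2 fun s' hs' t' ht' z hz => ?_
    exact hN.raise_lower_mem_level hA hs ht hs' ht' hz (lower_mem_level hs' ht' (ih hz))

theorem IsLeviStable.iSup_level_le_comap (hN : IsLeviStable A S N) (hA : IsGlRep A)
    (hN' : N ≤ raisingKernel A S) (a b : I) :
    ⨆ d, level A S N d ≤
      (⨆ d, level A S N d).comap (A a b) := by
  refine iSup_le fun d z hz => ?_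
  rw [Submodule.mem_comap]
  by_cases ha : a ∈ S <;> by_cases hb : b ∈ S
  · exact Submodule.mem_iSup_of_mem d (hN.level hA d a b (iff_of_true ha hb) hz)
  · cases d with
    | zero => simp only [mem_raisingKernel.1 (hN' hz) a ha b hb, zero_mem]
    | succ d => exact Submodule.mem_iSup_of_mem d (hN.raise_mem_level hA hN' ha hb d hz)
  · exact Submodule.mem_iSup_of_mem (d + 1) (lower_mem_level hb ha hz)
  · exact Submodule.mem_iSup_of_mem d (hN.level hA d a b (iff_of_false ha hb) hz)

theorem IsLeviStable.iSup_level_eq_top (hN : IsLeviStable A S N) (hA : IsGlRep A)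
    (hA' : IsSimpleFamily A) (hN' : N ≤ raisingKernel A S) (hN0 : N ≠ ⊥) :
    ⨆ d, level A S N d = ⊤ :=
  (hA' _ (hN.iSup_level_le_comap hA hN')).resolve_left
    (ne_bot_of_le_ne_bot hN0 (le_iSup (level A S N) 0))

end Levels

section Grading

variable {R I X : Type*} [CommRing R] [AddCommGroup X] [Module R X]

/-- The operator `∑_{s ∈ S} E_{s,s}`, whose eigenspaces contain the levels. -/
def gradingOp (A : I → I → Module.End R X) (S : Finset I) : Module.End R X := ∑ s ∈ S, A s s

variable [DecidableEq I] {A : I → I → Module.End R X} {S : Finset I} {N : Submodule R X}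

theorem IsGlRep.gradingOp_mul (hA : IsGlRep A) (a b : I) :
    gradingOp A S * A a b =
      A a b * gradingOp A S +
        ((if a ∈ S then 1 else 0) - (if b ∈ S then 1 else 0) : ℤ) • A a b := by
  simp only [gradingOp, Finset.sum_mul, Finset.mul_sum, hA.diag_mul, Finset.sum_add_distrib,
    ← Finset.sum_smul, Finset.sum_sub_distrib, Finset.sum_ite_eq]

theorem level_le_eigenspace (hA : IsGlRep A) {μ : R}
    (hN : N ≤ (gradingOp A S).eigenspace μ) (d : ℕ) :
    level A S N d ≤ (gradingOp A S).eigenspace (μ - d) := by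
  induction d with
  | zero => simpa only [level, Nat.cast_zero, sub_zero] using hN
  | succ d ih =>
    refine level_succ_le_iff.2 fun s hs t ht z hz => ?_
    have eigen_z := Module.End.mem_eigenspace_iff.1 (ih hz)
    have h := DFunLike.congr_fun (hA.gradingOp_mul (S := S) t s) z
    rw [Module.End.mul_apply, LinearMap.add_apply, Module.End.mul_apply, eigen_z, if_neg ht,
      if_pos hs, map_smul, LinearMap.smul_apply] at h
    rw [Module.End.mem_eigenspace_iff, h]
    push_cast
    module

theorem IsExtremal.mem_eigenspace_gradingOp {ℓ : R} {x : X} (hx : IsExtremal A S ℓ x) :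
    x ∈ (gradingOp A S).eigenspace (S.card * ℓ) := by
  simp only [Module.End.mem_eigenspace_iff, gradingOp, LinearMap.sum_apply, hx.apply_diag,
    ← Finset.sum_smul, Finset.sum_ite_mem, Finset.inter_self, Finset.sum_const, nsmul_eq_mul]

end Grading

section Extremal

variable {R I X : Type*} [CommRing R] [AddCommGroup X] [Module R X] [DecidableEq I]
  {A : I → I → Module.End R X} {S : Finset I} {ℓ : R} {x : X}

theorem IsExtremal.isLeviStable_span (hx : IsExtremal A S ℓ x) : IsLeviStable A S (R ∙ x) := by
  intro a b hab
  rw [Submodule.span_singleton_le_iff_mem, Submodule.mem_comap]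
  rcases eq_or_ne a b with rfl | h
  · rw [hx.apply_diag]
    exact Submodule.smul_mem _ _ (Submodule.mem_span_singleton_self x)
  · rw [hx.apply_eq_zero a b h hab.2]
    exact zero_mem _

theorem IsExtremal.span_le_raisingKernel (hx : IsExtremal A S ℓ x) :
    R ∙ x ≤ raisingKernel A S :=
  (Submodule.span_singleton_le_iff_mem _ _).2 <| mem_raisingKernel.2 fun s hs t ht =>
    hx.apply_eq_zero s t (ne_of_mem_of_not_mem hs ht) fun _ => hs

protected theorem IsExtremal.level_le_eigenspace (hx : IsExtremal A S ℓ x) (hA : IsGlRep A)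
    (d : ℕ) :
    level A S (R ∙ x) d ≤ (gradingOp A S).eigenspace (S.card * ℓ - d) :=
  level_le_eigenspace hA
    ((Submodule.span_singleton_le_iff_mem _ _).2 hx.mem_eigenspace_gradingOp) d

protected theorem IsExtremal.contragredient {T : Finset I} {r : Equiv.Perm I}
    (hx : IsExtremal A S ℓ x) (hT : ∀ a, a ∈ T ↔ r a ∉ S) :
    IsExtremal (traceShift (contragredient A r) ℓ) T ℓ x where
  ne_zero := hx.ne_zero
  apply_eq_zero a b hab h := by
    have hr : r a ∈ S → r b ∈ S := by simpa only [hT, not_imp_not] using h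
    simp [traceShift, contragredient, if_neg hab, hx.apply_eq_zero _ _ (r.injective.ne hab.symm) hr]
  apply_diag a := by
    by_cases h : r a ∈ S <;> simp [traceShift, contragredient, hx.apply_diag, hT, h]

theorem IsExtremal.reindex {J : Type*} [DecidableEq J] {j : J → I} {T : Finset J}
    (hx : IsExtremal A S ℓ x) (hj : Function.Injective j) (hT : ∀ a, a ∈ T ↔ j a ∈ S) :
    IsExtremal (fun a b => A (j a) (j b)) T ℓ x where
  ne_zero := hx.ne_zero
  apply_eq_zero a b hab h := hx.apply_eq_zero _ _ (hj.ne hab) (by rwa [← hT, ← hT])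
  apply_diag a := by simp only [hx.apply_diag, hT]

protected theorem IsSimpleFamily.traceShift (hA : IsSimpleFamily A) (c : R) :
    IsSimpleFamily (traceShift A c) := by
  refine fun U hU => hA U fun a b z hz => ?_
  have h := hU a b hz
  by_cases hab : a = b
  · rw [Submodule.mem_comap, traceShift, if_pos hab, LinearMap.add_apply,
      Module.algebraMap_end_apply] at h
    exact (Submodule.add_mem_iff_left U (U.smul_mem c hz)).1 h
  · rwa [traceShift, if_neg hab, add_zero] at h

theorem IsExtremal.prodMk {Y : Type*} [AddCommGroup Y] [Module R Y] {B : I → I → Module.End R Y}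
    {y : Y} (hx : IsExtremal A S ℓ x) (hy : IsExtremal B S ℓ y) :
    IsExtremal (fun a b => (A a b).prodMap (B a b)) S ℓ (x, y) where
  ne_zero h := hx.ne_zero (congrArg Prod.fst h)
  apply_eq_zero a b h h' := by simp [hx.apply_eq_zero a b h h', hy.apply_eq_zero a b h h']
  apply_diag a := by
    simp only [LinearMap.prodMap_apply, hx.apply_diag a, hy.apply_diag a, Prod.smul_mk]

end Extremal

section Nondegenerate

variable {K I X : Type*} [Field K] [AddCommGroup X] [Module K X]

/-- No nonzero vector of positive level over the line of `x` is annihilated by all raising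
operators. -/
def IsNondegenerate (A : I → I → Module.End K X) (S : Finset I) (x : X) : Prop :=
  ∀ d, Disjoint (level A S (K ∙ x) (d + 1)) (raisingKernel A S)

variable [DecidableEq I] {A : I → I → Module.End K X} {S : Finset I} {ℓ : K} {x : X}

theorem IsLeviStable.eigenspace_gradingOp {N : Submodule K X} (hN : IsLeviStable A S N)
    (hA : IsGlRep A) (hA' : IsSimpleFamily A) (hN' : N ≤ raisingKernel A S) (hN0 : N ≠ ⊥) {μ : K}
    (hμ : N ≤ (gradingOp A S).eigenspace μ) (ν : K) :
    (gradingOp A S).eigenspace ν = ⨆ (d : ℕ) (_ : μ - d = ν), level A S N d := by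
  have level_le (d : ℕ) := level_le_eigenspace hA hμ d
  have h : (fun ν => ⨆ (d : ℕ) (_ : μ - d = ν), level A S N d) = (gradingOp A S).eigenspace := by
    refine (((gradingOp A S).eigenspaces_iSupIndep).le_iff_eq_of_iSup_eq_top ?_).1 fun ν =>
      iSup₂_le fun d hd => hd ▸ level_le d
    rw [iSup_comm, ← hN.iSup_level_eq_top hA hA' hN' hN0]
    simp only [iSup_iSup_eq_right]
  exact (congrFun h ν).symm

variable [CharZero K]

theorem IsExtremal.isNondegenerate (hx : IsExtremal A S ℓ x) (hA : IsGlRep A)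
    (hA' : IsSimpleFamily A) : IsNondegenerate A S x := by
  intro d
  rw [disjoint_iff]
  by_contra hN0
  have eigen_x := hx.mem_eigenspace_gradingOp
  have hN : IsLeviStable A S (level A S (K ∙ x) (d + 1) ⊓ raisingKernel A S) := fun a b hab =>
    inf_le_inf (hx.isLeviStable_span.level hA _ a b hab) (isLeviStable_raisingKernel hA a b hab)
  have no_degree (e : ℕ) : ¬(S.card * ℓ - (d + 1 : ℕ) - e = S.card * ℓ) := by
    rw [sub_sub, sub_eq_self]
    norm_cast
    omega
  rw [hN.eigenspace_gradingOp hA hA' inf_le_right hN0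
    (inf_le_left.trans (hx.level_le_eigenspace hA _))] at eigen_x
  simp only [no_degree, iSup_false, iSup_bot, Submodule.mem_bot] at eigen_x
  exact hx.ne_zero eigen_x

theorem IsExtremal.eigenspace_gradingOp_le (hx : IsExtremal A S ℓ x) (hA : IsGlRep A)
    (hA' : IsSimpleFamily A) (k : ℕ) :
    (gradingOp A S).eigenspace (S.card * ℓ + k) ≤ K ∙ x := by
  rw [hx.isLeviStable_span.eigenspace_gradingOp hA hA' hx.span_le_raisingKernel
    (Submodule.span_singleton_eq_bot.not.2 hx.ne_zero)
    ((Submodule.span_singleton_le_iff_mem _ _).2 hx.mem_eigenspace_gradingOp)]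
  refine iSup₂_le fun d hd => ?_
  have degree_eq : d = 0 := by
    rw [sub_eq_iff_eq_add, add_assoc, left_eq_add] at hd
    norm_cast at hd
    omega
  rw [degree_eq, level]

theorem IsExtremal.of_diag_eq {A' : I → I → Module.End K X} (hx : IsExtremal A S ℓ x)
    (hA : IsGlRep A) (hA' : IsSimpleFamily A) (hB : IsGlRep A') (hdiag : ∀ a, A' a a = A a a) :
    IsExtremal A' S ℓ x where
  ne_zero := hx.ne_zero
  apply_diag a := by rw [hdiag, hx.apply_diag]
  apply_eq_zero a b hab h := by
    have grading_eq : gradingOp A' S = gradingOp A S := by simp only [gradingOp, hdiag]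
    -- `A' a b x` has `gradingOp`-degree at least that of `x`, so it is a multiple of `x`
    have mem_span : A' a b x ∈ K ∙ x := by
      refine hx.eigenspace_gradingOp_le hA hA' (if a ∈ S ∧ b ∉ S then 1 else 0) ?_
      have h := DFunLike.congr_fun (hB.gradingOp_mul (S := S) a b) x
      rw [grading_eq, Module.End.mul_apply, LinearMap.add_apply, Module.End.mul_apply,
        Module.End.mem_eigenspace_iff.1 hx.mem_eigenspace_gradingOp, map_smul] at h
      rw [Module.End.mem_eigenspace_iff, h, add_smul, LinearMap.smul_apply]
      by_cases ha : a ∈ S <;> by_cases hb : b ∈ S <;> simp_all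
    -- but its `ε_a`-weight exceeds that of `x` by `1`
    obtain ⟨c, hc⟩ := Submodule.mem_span_singleton.1 mem_span
    have h := DFunLike.congr_fun (hB.diag_mul a a b) x
    rw [Module.End.mul_apply, LinearMap.add_apply, Module.End.mul_apply, hdiag, hx.apply_diag,
      LinearMap.smul_apply, ← hc, map_smul, hx.apply_diag, map_smul, smul_comm c, hc,
      left_eq_add, if_pos rfl, if_neg hab.symm, sub_zero, one_smul] at h
    exact h

theorem IsExtremal.map_perm {g : (Module.End K X)ˣ} {w : Equiv.Perm I} (hx : IsExtremal A S ℓ x)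
    (hA : IsGlRep A) (hA' : IsSimpleFamily A)
    (hg : ∀ a, (g : Module.End K X) * A a a = A (w a) (w a) * g) :
    IsExtremal A (S.map w.toEmbedding) ℓ ((g : Module.End K X) x) := by
  have hconj : IsGlRep fun a b => (↑g⁻¹ : Module.End K X) * A (w a) (w b) * g :=
    (hA.reindex w.injective).map
      (MulSemiringAction.toRingHom _ (Module.End K X) (ConjAct.toConjAct g⁻¹))
  have hx' := hx.of_diag_eq hA hA' hconj fun a => by rw [mul_assoc, ← hg, Units.inv_mul_cancel_left]
  have apply_map (a b : I) : A (w a) (w b) ((g : Module.End K X) x) =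
      (g : Module.End K X) (((↑g⁻¹ : Module.End K X) * A (w a) (w b) * g) x) := by
    simp only [← Module.End.mul_apply, mul_assoc, Units.mul_inv_cancel_left]
  refine ⟨fun h => hx.ne_zero ?_, fun a b hab h => ?_, fun a => ?_⟩
  · simpa only [← Module.End.mul_apply, Units.inv_mul, Module.End.one_apply, map_zero] using
      congrArg (↑g⁻¹ : Module.End K X) h
  · obtain ⟨a, rfl⟩ := w.surjective a
    obtain ⟨b, rfl⟩ := w.surjective b
    rw [apply_map, hx'.apply_eq_zero a b (ne_of_apply_ne w hab) (by simpa using h), map_zero]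
  · obtain ⟨a, rfl⟩ := w.surjective a
    rw [apply_map, hx'.apply_diag, map_smul]
    simp

end Nondegenerate

section Block

variable {R I J X : Type*} [CommRing R] [AddCommGroup X] [Module R X]
  {A : I → I → Module.End R X} {S : Finset I} {T : Finset J} {j : J → I} {x : X}

theorem level_reindex_le {N : Submodule R X} (hT : ∀ a, a ∈ T ↔ j a ∈ S) (d : ℕ) :
    level (fun a b => A (j a) (j b)) T N d ≤ level A S N d := by
  induction d with
  | zero => exact le_rfl
  | succ d ih =>
    exact level_succ_le_iff.2 fun s hs t ht z hz =>
      lower_mem_level ((hT s).1 hs) ((hT t).not.1 ht) (ih hz)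

variable [DecidableEq I] {ℓ : R} {p q : I}

theorem IsExtremal.level_reindex_le_ker_of_mem (hx : IsExtremal A S ℓ x) (hA : IsGlRep A)
    (hpq : p ≠ q) (hp : p ∈ S) (hpj : p ∉ Set.range j) (d : ℕ) :
    level (fun a b => A (j a) (j b)) T (R ∙ x) d ≤ LinearMap.ker (A p q) := by
  induction d generalizing q with
  | zero =>
    exact (Submodule.span_singleton_le_iff_mem _ _).2 (hx.apply_eq_zero p q hpq fun _ => hp)
  | succ d ih =>
    refine level_succ_le_iff.2 fun a _ b _ z hz => ?_
    rw [LinearMap.mem_ker, ← Submodule.mem_bot R]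
    refine hA.apply_apply_mem ?_ (fun _ => ih (fun h => hpj ⟨a, h.symm⟩) hz) fun h =>
      absurd ⟨a, h⟩ hpj
    rw [LinearMap.mem_ker.1 (ih hpq hz), map_zero]
    exact zero_mem _

theorem IsExtremal.level_reindex_le_ker_of_notMem (hx : IsExtremal A S ℓ x) (hA : IsGlRep A)
    (hpq : p ≠ q) (hq : q ∉ S) (hqj : q ∉ Set.range j) (d : ℕ) :
    level (fun a b => A (j a) (j b)) T (R ∙ x) d ≤ LinearMap.ker (A p q) := by
  induction d generalizing p with
  | zero =>
    exact (Submodule.span_singleton_le_iff_mem _ _).2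
      (hx.apply_eq_zero p q hpq fun h => absurd h hq)
  | succ d ih =>
    refine level_succ_le_iff.2 fun a _ b _ z hz => ?_
    rw [LinearMap.mem_ker, ← Submodule.mem_bot R]
    refine hA.apply_apply_mem ?_ (fun h => absurd ⟨b, h.symm⟩ hqj) fun _ =>
      ih (fun h => hqj ⟨b, h⟩) hz
    rw [LinearMap.mem_ker.1 (ih hpq hz), map_zero]
    exact zero_mem _

end Block

section Graph

variable {K I X Y Z : Type*} [Field K] [DecidableEq I] [AddCommGroup X] [Module K X]
  [AddCommGroup Y] [Module K Y] [AddCommGroup Z] [Module K Z] {S : Finset I} {ℓ : K}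
  {A : I → I → Module.End K X} {B : I → I → Module.End K Y} {C : I → I → Module.End K Z}

theorem IsExtremal.isNondegenerate_reindex {J : Type*} {T : Finset J} {j : J → I} {x : X}
    (hx : IsExtremal A S ℓ x) (hA : IsGlRep A) (hx' : IsNondegenerate A S x)
    (hT : ∀ a, a ∈ T ↔ j a ∈ S) : IsNondegenerate (fun a b => A (j a) (j b)) T x := by
  refine fun d => Submodule.disjoint_def.2 fun z hz hz' => ?_
  refine Submodule.disjoint_def.1 (hx' d) z (level_reindex_le hT _ hz)
    (mem_raisingKernel.2 fun s hs t ht => ?_)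
  have hst : s ≠ t := ne_of_mem_of_not_mem hs ht
  by_cases hsj : s ∈ Set.range j
  · by_cases htj : t ∈ Set.range j
    · obtain ⟨a, rfl⟩ := hsj
      obtain ⟨b, rfl⟩ := htj
      exact mem_raisingKernel.1 hz' a ((hT a).2 hs) b ((hT b).not.2 ht)
    · exact hx.level_reindex_le_ker_of_notMem hA hst ht htj _ hz
  · exact hx.level_reindex_le_ker_of_mem hA hst hs hsj _ hz

theorem IsGlRep.prodMap (hA : IsGlRep A) (hB : IsGlRep B) :
    IsGlRep fun a b => (A a b).prodMap (B a b) :=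
  (hA.prodMk hB).map (LinearMap.prodMapAlgHom K X Y).toRingHom

theorem IsNondegenerate.disjoint_level_ker {f : Z →ₗ[K] X} {k : Z →ₗ[K] Y} {c : Z}
    (hB : IsNondegenerate B S (k c)) (hC : IsGlRep C) (hc : IsExtremal C S ℓ c)
    (hf : ∀ a b, f ∘ₗ C a b = A a b ∘ₗ f) (hk : ∀ a b, k ∘ₗ C a b = B a b ∘ₗ k)
    (hfk : Disjoint (LinearMap.ker f) (LinearMap.ker k)) (hfc : f c ≠ 0) (d : ℕ) :
    Disjoint (level C S (K ∙ c) d) (LinearMap.ker f) := by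
  induction d with
  | zero =>
    refine Submodule.disjoint_def.2 fun z hz hz' => ?_
    obtain ⟨r, rfl⟩ := Submodule.mem_span_singleton.1 hz
    rw [LinearMap.mem_ker, map_smul, smul_eq_zero_iff_left hfc] at hz'
    rw [hz', zero_smul]
  | succ d ih =>
    refine Submodule.disjoint_def.2 fun z hz hz' => Submodule.disjoint_def.1 hfk z hz' ?_
    -- induction shows `z` to be killed by all raising operators, so that `B` forces `k z = 0`
    have raise_eq_zero : ∀ s ∈ S, ∀ t ∉ S, C s t z = 0 := fun s hs t ht =>
      Submodule.disjoint_def.1 ih _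
        (hc.isLeviStable_span.raise_mem_level hC hc.span_le_raisingKernel hs ht d hz)
        (LinearMap.mem_ker.2 <| (DFunLike.congr_fun (hf s t) z).trans <| by
          rw [LinearMap.comp_apply, LinearMap.mem_ker.1 hz', map_zero])
    refine Submodule.disjoint_def.1 (hB d) (k z) ?_ (mem_raisingKernel.2 fun s hs t ht => ?_)
    · rw [← Set.image_singleton, ← Submodule.map_span, ← map_level hk]
      exact Submodule.mem_map_of_mem hz
    · rw [← LinearMap.comp_apply, ← hk, LinearMap.comp_apply, raise_eq_zero s hs t ht, map_zero]

end Graph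

/-! ### Lattices of divided power monomials -/

section DivPow

variable {E : Type*} [Ring E] [Algebra ℂ E] {X Y : Type*} [AddCommGroup X] [Module ℂ X]
  [AddCommGroup Y] [Module ℂ Y]

theorem divPow_zsmul (c : ℤ) (x : E) (m : ℕ) : divPow (c • x) m = c ^ m • divPow x m := by
  rw [divPow, divPow, smul_pow, smul_comm]

theorem divPow_neg (x : E) (m : ℕ) : divPow (-x) m = (-1 : ℤ) ^ m • divPow x m := by
  rw [← divPow_zsmul, neg_one_zsmul]

theorem mul_divPow_of_mul_eq {h f : E} {c : ℤ} (hf : h * f = f * h + c • f) (m : ℕ) :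
    h * divPow f m = divPow f m * h + (m * c) • divPow f m := by
  have mul_pow (m : ℕ) : h * f ^ m = f ^ m * h + (m * c) • f ^ m := by
    induction m with
    | zero => simp only [pow_zero, mul_one, one_mul, Nat.cast_zero, zero_mul, zero_smul, add_zero]
    | succ m ih =>
      rw [pow_succ, ← mul_assoc, ih, add_mul, mul_assoc, hf, mul_add, ← mul_assoc, mul_smul_comm,
        smul_mul_assoc, add_assoc, ← add_smul, Nat.cast_succ, add_one_mul, add_comm c]
  rw [divPow, mul_smul_comm, mul_pow, smul_add, smul_mul_assoc, smul_comm]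

theorem divPow_apply_eq_zero {f : Module.End ℂ X} {z : X} (h : f z = 0) {m : ℕ} (hm : m ≠ 0) :
    divPow f m z = 0 := by
  rw [divPow, LinearMap.smul_apply, ← Nat.succ_pred_eq_of_ne_zero hm, pow_succ,
    Module.End.mul_apply, h, map_zero, smul_zero]

theorem comp_divPow {u : X →ₗ[ℂ] Y} {f : Module.End ℂ X} {g : Module.End ℂ Y}
    (h : u ∘ₗ f = g ∘ₗ u) (m : ℕ) : u ∘ₗ divPow f m = divPow g m ∘ₗ u := by
  rw [divPow, divPow, LinearMap.comp_smul, LinearMap.smul_comp,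
    Module.End.commute_pow_left_of_commute h.symm m]

theorem binomElt_apply {h : Module.End ℂ X} {c : ℤ} {z : X} (hz : h z = c • z) (m : ℕ) :
    binomElt h m z = Ring.choose c m • z := by
  have eval_eq : (descPochhammer ℂ m).eval (c : ℂ) = (m ! : ℂ) * (Ring.choose c m : ℤ) := by
    have h := Ring.descPochhammer_eq_factorial_smul_choose c m
    rw [← Polynomial.eval_eq_smeval, nsmul_eq_mul] at h
    rw [← descPochhammer_map (Int.castRingHom ℂ), Polynomial.eval_intCast_map, Int.cast_id, h]
    simp
  rw [← Int.cast_smul_eq_zsmul ℂ] at hz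
  rw [binomElt, LinearMap.smul_apply, Module.End.aeval_apply_of_mem_apply_eq_smul hz, smul_smul,
    ← Int.cast_smul_eq_zsmul ℂ, eval_eq,
    inv_mul_cancel_left₀ (Nat.cast_ne_zero.2 m.factorial_ne_zero)]

/-- Rests on the formula for commuting divided powers in the Heisenberg algebra of `f`, `h` and the
central element `c = [f, h]`. -/
theorem divPow_divPow_apply_mem {f h c : Module.End ℂ X} (hfh : f * h = h * f + c)
    (hfc : Commute f c) (hhc : Commute h c) {L : ℕ → Submodule ℤ X}
    (hh : ∀ m e, ∀ y ∈ L e, divPow h m y ∈ L (e + m))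
    (hc : ∀ m e, ∀ y ∈ L e, divPow c m y ∈ L (e + m)) {d : ℕ} {z : X}
    (hz : ∀ m, divPow f m z ∈ L d) (m k : ℕ) : divPow f m (divPow h k z) ∈ L (d + k) := by
  rw [← Module.End.mul_apply, divPow_reorder hfh hfc hhc, LinearMap.sum_apply]
  refine sum_mem fun r _ => ?_
  rw [reorderTerm]
  split_ifs with hr
  · rw [mul_assoc, (divPow_commute hfc _ _).eq, ← mul_assoc, (divPow_commute hhc _ _).eq,
      mul_assoc, Module.End.mul_apply, Module.End.mul_apply]
    have mem := hc r _ _ (hh (k - r) _ _ (hz (m - r)))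
    rwa [add_assoc, Nat.sub_add_cancel hr.2] at mem
  · exact zero_mem _

end DivPow

section Monomials

variable {I X Y : Type*} [AddCommGroup X] [Module ℂ X] [AddCommGroup Y] [Module ℂ Y]

/-- The divided power monomials of degree `d` in the lowering operators `A t s`, `s ∈ S`, `t ∉ S`,
applied to the vector `x`. -/
inductive IsMonomial (A : I → I → Module.End ℂ X) (S : Finset I) (x : X) : ℕ → X → Prop
  | base : IsMonomial A S x 0 x
  | lower {s t : I} (hs : s ∈ S) (ht : t ∉ S) (m : ℕ) {d : ℕ} {z : X} (hz : IsMonomial A S x d z) :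
      IsMonomial A S x (d + m) (divPow (A t s) m z)

/-- The `ℤ`-span of the divided power monomials of degree `d`; it is a `ℤ`-form of the
`d`-th level. -/
def lattice (A : I → I → Module.End ℂ X) (S : Finset I) (x : X) (d : ℕ) : Submodule ℤ X :=
  Submodule.span ℤ {z | IsMonomial A S x d z}

/-- The `ℤ`-span of the divided power monomials of degree at most `d`; the degree is an integer so
that `d = -1` gives `0`. -/
def latticeLE (A : I → I → Module.End ℂ X) (S : Finset I) (x : X) (d : ℤ) : Submodule ℤ X :=
  ⨆ (e : ℕ) (_ : (e : ℤ) ≤ d), lattice A S x e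

variable {A : I → I → Module.End ℂ X} {B : I → I → Module.End ℂ Y} {S : Finset I} {x : X}

theorem mem_lattice_zero : x ∈ lattice A S x 0 := Submodule.subset_span .base

theorem divPow_lower_mem_lattice {s t : I} (hs : s ∈ S) (ht : t ∉ S) (m : ℕ) {d : ℕ} {z : X}
    (hz : z ∈ lattice A S x d) : divPow (A t s) m z ∈ lattice A S x (d + m) := by
  have h : lattice A S x d ≤
      (lattice A S x (d + m)).comap ((divPow (A t s) m).restrictScalars ℤ) :=
    Submodule.span_le.2 fun z hz => Submodule.subset_span (IsMonomial.lower hs ht m hz)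
  exact h hz

theorem divPow_lower_mem_level {s t : I} (hs : s ∈ S) (ht : t ∉ S) {N : Submodule ℂ X} (m : ℕ)
    {d : ℕ} {z : X} (hz : z ∈ level A S N d) : divPow (A t s) m z ∈ level A S N (d + m) := by
  rw [divPow, LinearMap.smul_apply]
  refine Submodule.smul_mem _ _ ?_
  induction m with
  | zero => exact hz
  | succ m ih =>
    rw [pow_succ', Module.End.mul_apply]
    exact lower_mem_level hs ht ih

theorem lattice_le_level (d : ℕ) :
    lattice A S x d ≤ (level A S (ℂ ∙ x) d).restrictScalars ℤ := by
  refine Submodule.span_le.2 fun z hz => ?_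
  rw [SetLike.mem_coe, Submodule.restrictScalars_mem]
  induction hz with
  | base => exact Submodule.mem_span_singleton_self x
  | lower hs ht m _ ih => exact divPow_lower_mem_level hs ht m ih

theorem lattice_le_latticeLE {d : ℤ} {e : ℕ} (h : (e : ℤ) ≤ d) :
    lattice A S x e ≤ latticeLE A S x d :=
  le_iSup₂ (f := fun (e : ℕ) (_ : (e : ℤ) ≤ d) => lattice A S x e) e h

theorem latticeLE_le_sup (d : ℕ) :
    latticeLE A S x d ≤ lattice A S x d ⊔ latticeLE A S x ((d : ℤ) - 1) := by
  refine iSup₂_le fun e he => ?_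
  rcases eq_or_ne e d with rfl | h
  · exact le_sup_left
  · exact le_sup_of_le_right (lattice_le_latticeLE (by omega))

theorem map_lattice {f : X →ₗ[ℂ] Y} (hf : ∀ a b, f ∘ₗ A a b = B a b ∘ₗ f) (d : ℕ) :
    (lattice A S x d).map (f.restrictScalars ℤ) = lattice B S (f x) d := by
  have map_divPow (a b : I) (m : ℕ) (z : X) : f (divPow (A a b) m z) = divPow (B a b) m (f z) :=
    DFunLike.congr_fun (comp_divPow (hf a b) m) z
  rw [lattice, Submodule.map_span]
  congr 1
  ext y
  constructor
  · rintro ⟨z, hz, rfl⟩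
    induction hz with
    | base => exact .base
    | lower hs ht m _ ih => exact (map_divPow _ _ m _).symm ▸ IsMonomial.lower hs ht m ih
  · intro hy
    induction hy with
    | base => exact ⟨x, .base, rfl⟩
    | lower hs ht m _ ih =>
      obtain ⟨z, hz, rfl⟩ := ih
      exact ⟨_, IsMonomial.lower hs ht m hz, map_divPow _ _ m z⟩

theorem IsMonomial.exists_apply_eq_smul {h : Module.End ℂ X} {d : ℕ} {z : X}
    (hz : IsMonomial A S x d z)
    (hA : ∀ s ∈ S, ∀ t ∉ S, ∃ c : ℤ, h * A t s = A t s * h + c • A t s)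
    (hx : ∃ c : ℤ, h x = c • x) : ∃ c : ℤ, h z = c • z := by
  induction hz with
  | base => exact hx
  | @lower s t hs ht m _ z _ ih =>
    obtain ⟨c, hc⟩ := hA s hs t ht
    obtain ⟨c', hc'⟩ := ih
    refine ⟨c' + m * c, ?_⟩
    rw [← Module.End.mul_apply, mul_divPow_of_mul_eq hc, LinearMap.add_apply, Module.End.mul_apply,
      hc', map_zsmul, LinearMap.smul_apply, add_smul]

end Monomials

section Comparison

variable {I X Y : Type*} [DecidableEq I] [AddCommGroup X] [Module ℂ X] [AddCommGroup Y] [Module ℂ Y]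
  {A : I → I → Module.End ℂ X} {B : I → I → Module.End ℂ Y} {S : Finset I} {ℓ : ℂ} {x : X} {y : Y}
  {a b s t : I}

theorem IsGlRep.exists_levi_mul_lower (hA : IsGlRep A) (hab : a ≠ b) (h : a ∈ S ↔ b ∈ S)
    (hs : s ∈ S) (ht : t ∉ S) : ∃ c : ℤ, ∃ s' ∈ S, ∃ t' ∉ S,
      A a b * A t s = A t s * A a b + c • A t' s' ∧
        Commute (A a b) (A t' s') ∧ Commute (A t s) (A t' s') := by
  have hst : s ≠ t := ne_of_mem_of_not_mem hs ht
  have commutator := hA a b t s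
  rw [sub_eq_iff_eq_add'] at commutator
  rcases eq_or_ne b t with rfl | hbt
  · have ha : a ∉ S := h.not.2 ht
    have hsa : s ≠ a := ne_of_mem_of_not_mem hs ha
    refine ⟨1, s, hs, a, ha, ?_, hA.commute hab.symm hsa, hA.commute hsa hst⟩
    rw [commutator, if_pos rfl, if_neg hsa, sub_zero, one_smul]
  · rcases eq_or_ne s a with rfl | hsa
    · refine ⟨-1, b, h.1 hs, t, ht, ?_, hA.commute hbt hab.symm, hA.commute hst hbt⟩
      rw [commutator, if_neg hbt, if_pos rfl, zero_sub, neg_one_smul]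
    · refine ⟨0, s, hs, t, ht, ?_, hA.commute hbt hsa, .refl _⟩
      rw [commutator, if_neg hbt, if_neg hsa, sub_zero, zero_smul]

theorem IsExtremal.divPow_levi_mem_lattice (hx : IsExtremal A S ℓ x) (hA : IsGlRep A) (hab : a ≠ b)
    (h : a ∈ S ↔ b ∈ S) (m : ℕ) {d : ℕ} {z : X} (hz : z ∈ lattice A S x d) :
    divPow (A a b) m z ∈ lattice A S x d := by
  have monomial_mem {d : ℕ} {z : X} (hz : IsMonomial A S x d z) :
      ∀ m, divPow (A a b) m z ∈ lattice A S x d := by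
    induction hz with
    | base =>
      intro m
      rcases eq_or_ne m 0 with rfl | hm
      · rw [divPow_zero]
        exact mem_lattice_zero
      · rw [divPow_apply_eq_zero (hx.apply_eq_zero a b hab h.2) hm]
        exact zero_mem _
    | @lower s t hs ht k d z _ ih =>
      intro m
      obtain ⟨c, s', hs', t', ht', mul_eq, commute, commute'⟩ :=
        hA.exists_levi_mul_lower hab h hs ht
      refine divPow_divPow_apply_mem mul_eq (commute.smul_right c) (commute'.smul_right c)
        (fun m e y hy => divPow_lower_mem_lattice hs ht m hy) (fun m e y hy => ?_) ih m k
      rw [divPow_zsmul]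
      exact Submodule.smul_mem _ _ (divPow_lower_mem_lattice hs' ht' m hy)
  have h : lattice A S x d ≤ (lattice A S x d).comap ((divPow (A a b) m).restrictScalars ℤ) :=
    Submodule.span_le.2 fun z hz => monomial_mem hz m
  exact h hz

theorem IsExtremal.iSupIndep_lattice (hx : IsExtremal A S ℓ x) (hA : IsGlRep A) :
    iSupIndep (lattice A S x) := by
  have level_indep : iSupIndep (level A S (ℂ ∙ x)) :=
    ((gradingOp A S).eigenspaces_iSupIndep.comp fun d e h =>
      Nat.cast_injective (sub_right_injective h)).mono (hx.level_le_eigenspace hA)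
  intro d
  refine ((Submodule.disjoint_restrictScalars_iff ℤ).2 (level_indep d)).mono (lattice_le_level d) ?_
  simp only [Submodule.restrictScalars_iSup]
  exact iSup₂_mono fun e _ => lattice_le_level e

theorem IsExtremal.disjoint_lattice_latticeLE (hx : IsExtremal A S ℓ x) (hA : IsGlRep A) {d : ℕ}
    {e : ℤ} (h : e < d) : Disjoint (lattice A S x d) (latticeLE A S x e) :=
  (hx.iSupIndep_lattice hA).disjoint_biSup (y := {k : ℕ | (k : ℤ) ≤ e})
    (fun hd => absurd hd (not_le.2 h))

/-- Restriction of an equivariant map to the `ℤ`-forms of a level on which it is injective. -/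
def latticeMapEquiv {f : X →ₗ[ℂ] Y} (hf : ∀ a b, f ∘ₗ A a b = B a b ∘ₗ f) {d : ℕ}
    (h : Disjoint (level A S (ℂ ∙ x) d) (LinearMap.ker f)) :
    lattice A S x d ≃ₗ[ℤ] lattice B S (f x) d :=
  .ofBijective ((f.restrictScalars ℤ).submoduleMap (lattice A S x d))
    ⟨(injective_iff_map_eq_zero _).2 fun z hz => Subtype.ext <|
        Submodule.disjoint_def.1 h z (lattice_le_level d z.2) (congrArg Subtype.val hz),
      LinearMap.submoduleMap_surjective _ _⟩ ≪≫ₗ .ofEq _ _ (map_lattice hf d)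

theorem exists_latticeEquiv_of_correspondence {Z : Type*} [AddCommGroup Z] [Module ℂ Z]
    {C : I → I → Module.End ℂ Z} {c : Z} {f : Z →ₗ[ℂ] X} {k : Z →ₗ[ℂ] Y} (hC : IsGlRep C)
    (hc : IsExtremal C S ℓ c) (hf : ∀ a b, f ∘ₗ C a b = A a b ∘ₗ f)
    (hk : ∀ a b, k ∘ₗ C a b = B a b ∘ₗ k)
    (hfk : Disjoint (LinearMap.ker f) (LinearMap.ker k)) (hfc : f c = x) (hkc : k c = y)
    (hx : x ≠ 0) (hy : y ≠ 0) (hA : IsNondegenerate A S x) (hB : IsNondegenerate B S y) :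
    ∃ e : ∀ d, lattice A S x d ≃ₗ[ℤ] lattice B S y d,
      ∀ {s t} (hs : s ∈ S) (ht : t ∉ S) m d (z : lattice A S x d),
        (e (d + m) ⟨divPow (A t s) m z, divPow_lower_mem_lattice hs ht m z.2⟩ : Y) =
          divPow (B t s) m (e d z) := by
  subst hfc hkc
  let e₁ (d : ℕ) := latticeMapEquiv hf (hB.disjoint_level_ker hC hc hf hk hfk hx d)
  let e₂ (d : ℕ) := latticeMapEquiv hk (hA.disjoint_level_ker hC hc hk hf hfk.symm hy d)
  refine ⟨fun d => (e₁ d).symm ≪≫ₗ e₂ d, fun {s t} hs ht m d z => ?_⟩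
  obtain ⟨z, rfl⟩ := (e₁ d).surjective z
  have e₁_lower : (⟨divPow (A t s) m (e₁ d z), divPow_lower_mem_lattice hs ht m (e₁ d z).2⟩ :
      lattice A S (f c) (d + m)) =
        e₁ (d + m) ⟨divPow (C t s) m z, divPow_lower_mem_lattice hs ht m z.2⟩ :=
    Subtype.ext (DFunLike.congr_fun (comp_divPow (hf t s) m) (z : Z)).symm
  rw [e₁_lower]
  simp only [LinearEquiv.trans_apply, LinearEquiv.symm_apply_apply]
  exact DFunLike.congr_fun (comp_divPow (hk t s) m) (z : Z)

theorem exists_latticeEquiv (hA : IsGlRep A) (hB : IsGlRep B) (hx : IsExtremal A S ℓ x)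
    (hy : IsExtremal B S ℓ y) (hx' : IsNondegenerate A S x) (hy' : IsNondegenerate B S y) :
    ∃ e : ∀ d, lattice A S x d ≃ₗ[ℤ] lattice B S y d,
      ∀ {s t} (hs : s ∈ S) (ht : t ∉ S) m d (z : lattice A S x d),
        (e (d + m) ⟨divPow (A t s) m z, divPow_lower_mem_lattice hs ht m z.2⟩ : Y) =
          divPow (B t s) m (e d z) :=
  have disjoint_ker : Disjoint (LinearMap.ker (.fst ℂ X Y)) (LinearMap.ker (.snd ℂ X Y)) :=
    Submodule.disjoint_def.2 fun _ h h' => Prod.ext h h'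
  exists_latticeEquiv_of_correspondence (hA.prodMap hB) (hx.prodMk hy)
    (fun _ _ => LinearMap.ext fun _ => rfl) (fun _ _ => LinearMap.ext fun _ => rfl)
    disjoint_ker rfl rfl hx.ne_zero hy.ne_zero hx' hy'

end Comparison

/-! ### Matrix units on `𝔰𝔩_N`-modules -/

section SpecialLinear

attribute [local instance 100] LieRing.ofAssociativeRing

variable {N : ℕ}

/-- The index set of the fundamental weight `ω_k`. -/
def initialSet (N k : ℕ) : Finset (Fin N) := {t | (t : ℕ) < k}

theorem mem_initialSet {k : ℕ} {t : Fin N} : t ∈ initialSet N k ↔ (t : ℕ) < k := by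
  simp [initialSet]

theorem card_initialSet {k : ℕ} (h : k ≤ N) : (initialSet N k).card = k := by
  rw [initialSet, Fin.card_filter_val_lt, min_eq_right h]

variable (N) in
/-- The projection of `𝔤𝔩_N` to `𝔰𝔩_N` along the scalar matrices. -/
def slProj : Matrix (Fin N) (Fin N) ℂ →ₗ[ℂ] SlN N :=
  LinearMap.codRestrict (LieAlgebra.SpecialLinear.sl (Fin N) ℂ).toSubmodule
    (.id - (Matrix.traceLinearMap (Fin N) ℂ ℂ).smulRight ((N : ℂ)⁻¹ • 1)) fun M => by
      have trace_eq : (N : ℂ) = 0 → M.trace = 0 := fun h => by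
        obtain rfl : N = 0 := Nat.cast_eq_zero.1 h
        exact Matrix.trace_fin_zero M
      change (M - M.trace • (N : ℂ)⁻¹ • (1 : Matrix (Fin N) (Fin N) ℂ)).trace = 0
      rw [Matrix.trace_sub, Matrix.trace_smul, Matrix.trace_smul, Matrix.trace_one,
        Fintype.card_fin, smul_eq_mul, smul_eq_mul, ← mul_assoc, ← div_eq_mul_inv,
        div_mul_cancel_of_imp trace_eq, sub_self]

theorem coe_slProj (M : Matrix (Fin N) (Fin N) ℂ) :
    (slProj N M : Matrix (Fin N) (Fin N) ℂ) = M - M.trace • (N : ℂ)⁻¹ • 1 := rfl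

theorem coe_slProj_of_trace_eq_zero {M : Matrix (Fin N) (Fin N) ℂ} (h : M.trace = 0) :
    (slProj N M : Matrix (Fin N) (Fin N) ℂ) = M := by
  rw [coe_slProj, h, zero_smul, sub_zero]

theorem slProj_coe (x : SlN N) : slProj N (x : Matrix (Fin N) (Fin N) ℂ) = x :=
  Subtype.ext (coe_slProj_of_trace_eq_zero x.2)

theorem slProj_single {a b : Fin N} (h : a ≠ b) :
    slProj N (Matrix.single a b 1) = elemMat a b h :=
  slProj_coe (elemMat a b h)

theorem coe_slProj_single_self (a : Fin N) :
    (slProj N (Matrix.single a a 1) : Matrix (Fin N) (Fin N) ℂ) =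
      Matrix.diagonal fun t => (if t = a then 1 else 0) - (N : ℂ)⁻¹ := by
  rw [coe_slProj, Matrix.trace_single_eq_same, one_smul, ← Matrix.diagonal_one,
    ← Matrix.diagonal_smul, ← Matrix.diagonal_single, Matrix.diagonal_sub]
  congr 1
  ext t
  simp [Pi.single_apply]

theorem lie_slProj (M M' : Matrix (Fin N) (Fin N) ℂ) :
    ⁅slProj N M, slProj N M'⁆ = slProj N (M * M' - M' * M) := by
  have trace_eq_zero : (M * M' - M' * M).trace = 0 := by
    rw [Matrix.trace_sub, Matrix.trace_mul_comm, sub_self]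
  apply Subtype.ext
  rw [coe_slProj_of_trace_eq_zero trace_eq_zero, LieAlgebra.SpecialLinear.sl_bracket, coe_slProj,
    coe_slProj]
  simp only [mul_sub, sub_mul, mul_smul_comm, smul_mul_assoc, mul_one, one_mul]
  module

theorem isGlRep_single : IsGlRep fun a b : Fin N => Matrix.single a b (1 : ℂ) := by
  intro a b c d
  have single_mul (a b c d : Fin N) : Matrix.single a b (1 : ℂ) * Matrix.single c d 1 =
      if b = c then Matrix.single a d 1 else 0 := by
    split_ifs with h
    · rw [h, Matrix.single_mul_single_same, one_mul]
    · exact Matrix.single_mul_single_of_ne _ _ _ _ h _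
  rw [single_mul, single_mul]

theorem sum_smul_slProj_single (x : SlN N) :
    ∑ a, ∑ b, (x : Matrix (Fin N) (Fin N) ℂ) a b • slProj N (Matrix.single a b 1) = x := by
  conv_rhs => rw [← slProj_coe x, Matrix.matrix_eq_sum_single (x : Matrix (Fin N) (Fin N) ℂ)]
  simp only [map_sum, ← map_smul, Matrix.smul_single, smul_eq_mul, mul_one]

section Modules

variable {V : Type*} [AddCommGroup V] [Module ℂ V] [LieRingModule (SlN N) V]
  [LieModule ℂ (SlN N) V]

variable (V) in
/-- The action on an `𝔰𝔩_N`-module of the traceless parts of the matrix units `E_{a,b}`. -/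
def slUnit (a b : Fin N) : Module.End ℂ V :=
  LieModule.toEnd ℂ (SlN N) V (slProj N (Matrix.single a b 1))

variable (V) in
/-- The action of the matrix units on the extension of an `𝔰𝔩_N`-module to `𝔤𝔩_N` in which the
identity matrix acts by `N κ`. -/
def matUnit (κ : ℂ) : Fin N → Fin N → Module.End ℂ V := traceShift (slUnit V) κ

theorem isGlRep_slUnit : IsGlRep (slUnit (N := N) V) := by
  intro a b c d
  have h := congrArg (fun M => LieModule.toEnd ℂ (SlN N) V (slProj N M)) (isGlRep_single a b c d)
  rw [← lie_slProj, LieHom.map_lie, LieRing.of_associative_ring_bracket, map_sub, map_sub] at h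
  simpa only [slUnit, apply_ite (slProj N), apply_ite (LieModule.toEnd ℂ (SlN N) V), map_zero]
    using h

theorem isGlRep_matUnit (κ : ℂ) : IsGlRep (matUnit (N := N) V κ) := isGlRep_slUnit.traceShift κ

theorem isSimpleFamily_slUnit [LieModule.IsIrreducible ℂ (SlN N) V] :
    IsSimpleFamily (slUnit (N := N) V) := by
  intro U hU
  let U' : LieSubmodule ℂ (SlN N) V :=
    { U with
      lie_mem := fun {x z} hz => by
        change ⁅x, z⁆ ∈ U
        rw [← LieModule.toEnd_apply_apply ℂ, ← sum_smul_slProj_single x]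
        simp only [map_sum, LinearMap.sum_apply, map_smul, LinearMap.smul_apply]
        exact sum_mem fun a _ => sum_mem fun b _ => U.smul_mem _ (hU a b hz) }
  exact (eq_bot_or_eq_top U').imp (congrArg LieSubmodule.toSubmodule)
    (congrArg LieSubmodule.toSubmodule)

theorem isSimpleFamily_matUnit [LieModule.IsIrreducible ℂ (SlN N) V] (κ : ℂ) :
    IsSimpleFamily (matUnit (N := N) V κ) :=
  isSimpleFamily_slUnit.traceShift κ

theorem matUnit_of_ne (κ : ℂ) {a b : Fin N} (h : a ≠ b) :
    matUnit V κ a b = LieModule.toEnd ℂ (SlN N) V (elemMat a b h) := by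
  rw [matUnit, traceShift, if_neg h, add_zero, slUnit, slProj_single h]

theorem matUnit_self (κ : ℂ) (a : Fin N) :
    matUnit V κ a a = slUnit V a a + algebraMap ℂ (Module.End ℂ V) κ := by
  rw [matUnit, traceShift, if_pos rfl]

theorem IsWeylRepresentative.mul_matUnit {w : Equiv.Perm (Fin N)} {g : (Module.End ℂ V)ˣ}
    (hg : IsWeylRepresentative w g) (κ : ℂ) (a : Fin N) :
    (g : Module.End ℂ V) * matUnit V κ a a = matUnit V κ (w a) (w a) * g := by
  have h := hg.conj _ _ (slProj N (Matrix.single (w a) (w a) 1)) (coe_slProj_single_self a) (by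
    simp only [coe_slProj_single_self, Equiv.symm_apply_eq])
  rw [matUnit_self, matUnit_self, mul_add, add_mul, Algebra.commutes, slUnit, slUnit, h]

end Modules

theorem weightVal_single (k : Set.Ioo 0 N) (ℓ : ℤ) (d : Fin N → ℂ) :
    weightVal (Pi.single k ℓ) d = ℓ * ∑ t ∈ initialSet N k, d t := by
  rw [weightVal, Finset.sum_eq_single k]
  · rw [Pi.single_eq_same, initialSet, Finset.sum_filter]
  · intro b _ hb
    rw [Pi.single_eq_of_ne hb, Int.cast_zero, zero_mul]
  · exact fun h => absurd (Finset.mem_univ k) h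

theorem Psi_single {n : ℕ} (i : Set.Ioo 0 n) (ℓ : ℤ) :
    Psi (Pi.single i ℓ) =
      Pi.single ⟨2 * (i : ℕ), by have := i.2.1; omega, by have := i.2.2; omega⟩ ℓ := by
  rw [Psi, Finset.sum_eq_single i]
  · rw [Pi.single_eq_same]
  · intro b _ hb
    rw [Pi.single_eq_of_ne hb, Pi.single_zero]
  · exact fun h => absurd (Finset.mem_univ i) h

theorem coe_lie_elemMat {p q : Fin N} (h : p ≠ q) :
    ((⁅elemMat p q h, elemMat q p h.symm⁆ : SlN N) : Matrix (Fin N) (Fin N) ℂ) =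
      Matrix.diagonal fun t => (if t = p then 1 else 0) - (if t = q then 1 else 0) := by
  rw [LieAlgebra.SpecialLinear.sl_bracket]
  ext a b
  simp only [elemMat, LieAlgebra.SpecialLinear.val_single, Matrix.single_mul_single_same,
    Matrix.sub_apply, Matrix.single_apply, Matrix.diagonal_apply]
  grind

theorem isSl2Triple_elemMat {p q : Fin N} (h : p ≠ q) :
    IsSl2Triple ⁅elemMat p q h, elemMat q p h.symm⁆ (elemMat p q h) (elemMat q p h.symm) where
  h_ne_zero h0 := by
    have entry := congrFun₂ (coe_lie_elemMat h) p p
    rw [h0, Matrix.diagonal_apply_eq, if_pos rfl, if_neg h, sub_zero] at entry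
    exact zero_ne_one entry
  lie_e_f := rfl
  lie_h_e_nsmul := by
    apply Subtype.ext
    rw [LieAlgebra.SpecialLinear.sl_bracket, coe_lie_elemMat]
    ext a b
    simp only [elemMat, LieAlgebra.SpecialLinear.val_single, Matrix.sub_apply,
      Matrix.diagonal_mul, Matrix.mul_diagonal,
      Matrix.single_apply, two_smul, AddMemClass.coe_add, Matrix.add_apply]
    grind
  lie_h_f_nsmul := by
    apply Subtype.ext
    rw [LieAlgebra.SpecialLinear.sl_bracket, coe_lie_elemMat]
    ext a b
    simp only [elemMat, LieAlgebra.SpecialLinear.val_single, Matrix.sub_apply,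
      Matrix.diagonal_mul, Matrix.mul_diagonal, NegMemClass.coe_neg, Matrix.neg_apply,
      Matrix.single_apply, two_smul, AddMemClass.coe_add, Matrix.add_apply]
    grind

section HighestWeight

variable {V : Type*} [AddCommGroup V] [Module ℂ V] [LieRingModule (SlN N) V]
  [LieModule ℂ (SlN N) V] {v : V}

theorem IsHighestWeightVector.lower_eq_zero [FiniteDimensional ℂ V] {μ : IntWeight N}
    (hv : IsHighestWeightVector μ v) {p q : Fin N} (h : p < q)
    (hpq : weightVal μ (fun t => (if t = p then 1 else 0) - (if t = q then 1 else 0)) = 0) :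
    ⁅elemMat q p h.ne', v⁆ = 0 := by
  have primitive : (isSl2Triple_elemMat h.ne).HasPrimitiveVectorWith v (0 : ℂ) :=
    { ne_zero := hv.ne_zero
      lie_h := by rw [hv.weight _ _ (coe_lie_elemMat h.ne), hpq]
      lie_e := hv.raising p q h }
  simpa using primitive.pow_toEnd_f_eq_zero_of_eq_nat (n := 0) (by simp)

/-- The shift by `ℓ k / N` makes the weight of `v` equal to `ℓ (ε_1 + ⋯ + ε_k)`. -/
theorem IsHighestWeightVector.matUnit_self_apply {k : Set.Ioo 0 N} {ℓ : ℤ}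
    (hv : IsHighestWeightVector (Pi.single k ℓ) v) (a : Fin N) :
    matUnit V (ℓ * k / N) a a v = (if a ∈ initialSet N k then (ℓ : ℂ) else 0) • v := by
  rw [matUnit_self, LinearMap.add_apply, slUnit, LieModule.toEnd_apply_apply,
    hv.weight _ _ (coe_slProj_single_self a), weightVal_single, Module.algebraMap_end_apply,
    ← add_smul, Finset.sum_sub_distrib, Finset.sum_ite_eq', Finset.sum_const,
    card_initialSet k.2.2.le, nsmul_eq_mul]
  congr 1
  split_ifs <;> ring

theorem IsHighestWeightVector.isExtremal [FiniteDimensional ℂ V] {k : Set.Ioo 0 N} {ℓ : ℤ}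
    (hv : IsHighestWeightVector (Pi.single k ℓ) v) :
    IsExtremal (matUnit V (ℓ * k / N)) (initialSet N k) ℓ v where
  ne_zero := hv.ne_zero
  apply_diag := hv.matUnit_self_apply
  apply_eq_zero a b hab h := by
    rw [matUnit_of_ne _ hab, LieModule.toEnd_apply_apply]
    rcases lt_or_gt_of_ne hab with hlt | hgt
    · exact hv.raising a b hlt
    · have mem_iff : a ∈ initialSet N k ↔ b ∈ initialSet N k :=
        ⟨fun ha => mem_initialSet.2 (lt_trans hgt (mem_initialSet.1 ha)), h⟩
      refine hv.lower_eq_zero hgt ?_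
      simp only [weightVal_single, Finset.sum_sub_distrib, Finset.sum_ite_eq', mem_iff, sub_self,
        mul_zero]

end HighestWeight

end SpecialLinear

/-! ### The Demazure module as a sum of lattices -/

section HyperalgebraAction

attribute [local instance 100] LieRing.ofAssociativeRing

variable {N : ℕ} {V : Type*} [AddCommGroup V] [Module ℂ V] [LieRingModule (SlN N) V]
  [LieModule ℂ (SlN N) V]

theorem uAct_ι (x : SlN N) :
    uAct V (UniversalEnvelopingAlgebra.ι ℂ x) = LieModule.toEnd ℂ (SlN N) V x := by
  rw [uAct, UniversalEnvelopingAlgebra.lift_ι_apply]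

theorem uAct_divPow_rootVec (κ : ℂ) {p q : Fin N} (h : p ≠ q) (m : ℕ) :
    uAct V (divPow (rootVec p q h) m) = divPow (matUnit V κ p q) m := by
  rw [divPow, divPow, map_smul, map_pow, rootVec, uAct_ι, matUnit_of_ne κ h]

theorem uAct_simpleCoroot (κ : ℂ) (j : ℕ) (h : j + 1 < N) :
    uAct V (simpleCoroot j h : UN N) =
      matUnit (N := N) V κ ⟨j, by omega⟩ ⟨j, by omega⟩ - matUnit V κ ⟨j + 1, h⟩ ⟨j + 1, h⟩ := by
  rw [simpleCoroot, uAct_ι, matUnit_self, matUnit_self, add_sub_add_right_eq_sub, slUnit, slUnit,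
    ← map_sub, ← map_sub, ← slProj_coe (LieAlgebra.SpecialLinear.singleSubSingle _ _ _)]
  rfl

theorem uAct_binomElt_simpleCoroot (κ : ℂ) (j : ℕ) (h : j + 1 < N) (m : ℕ) :
    uAct V (binomElt (simpleCoroot j h : UN N) m) =
      binomElt (matUnit (N := N) V κ ⟨j, by omega⟩ ⟨j, by omega⟩ -
        matUnit V κ ⟨j + 1, h⟩ ⟨j + 1, h⟩) m := by
  rw [binomElt, binomElt, map_smul, ← Polynomial.aeval_algHom_apply, uAct_simpleCoroot κ]

theorem uAct_mem_of_mem_hyperBorel {L : Submodule ℤ V}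
    (hroot : ∀ (p q : Fin N) (h : p < q) (m : ℕ) (z), z ∈ L →
      uAct V (divPow (rootVec p q h.ne) m) z ∈ L)
    (hcoroot : ∀ (j : ℕ) (h : j + 1 < N) (m : ℕ) (z), z ∈ L →
      uAct V (binomElt (simpleCoroot j h) m) z ∈ L)
    {u : UN N} (hu : u ∈ hyperBorel N) {z : V} (hz : z ∈ L) : uAct V u z ∈ L := by
  induction hu using Algebra.adjoin_induction generalizing z with
  | mem u hu =>
    rcases hu with ⟨p, q, h, m, rfl⟩ | ⟨j, h, m, rfl⟩
    · exact hroot p q h m z hz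
    · exact hcoroot j h m z hz
  | algebraMap r =>
    rw [Algebra.algebraMap_eq_smul_one, map_zsmul, map_one]
    exact L.smul_mem r hz
  | add u u' _ _ h h' =>
    rw [map_add, LinearMap.add_apply]
    exact add_mem (h hz) (h' hz)
  | mul u u' _ _ h h' =>
    rw [map_mul, Module.End.mul_apply]
    exact h (h' hz)

theorem mem_demazure (g : (Module.End ℂ V)ˣ) (v : V) :
    (g : Module.End ℂ V) v ∈ demazure N g v :=
  ⟨1, one_mem (hyperBorel N), by simp [orbitMap]⟩

end HyperalgebraAction

section TauBlock

variable {n : ℕ}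

/-- The index of `𝔤𝔩_{2n}` corresponding to the index `a` of the copy of `𝔤𝔩_n` that contains the
root vectors `E_{φ(α)}` acting nontrivially on the Demazure module. -/
def blockIndex (n i : ℕ) (a : Fin n) : Fin (2 * n) :=
  if (a : ℕ) < i then ⟨n + a, by omega⟩ else ⟨a, by omega⟩

/-- The index set of the weight `τ(ω̃_{2i})`. -/
def tauSet (n i : ℕ) : Finset (Fin (2 * n)) := (initialSet (2 * n) (2 * i)).map (tau n).toEmbedding

theorem val_blockIndex (i : ℕ) (a : Fin n) :
    (blockIndex n i a : ℕ) = if (a : ℕ) < i then n + a else a := by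
  unfold blockIndex
  split_ifs <;> rfl

theorem blockIndex_injective (i : ℕ) : Function.Injective (blockIndex n i) := by
  intro a b h
  have hval := congrArg Fin.val h
  rw [val_blockIndex, val_blockIndex] at hval
  ext
  split_ifs at hval <;> omega

theorem mem_tauSet {i : ℕ} (hi : i < n) {t : Fin (2 * n)} :
    t ∈ tauSet n i ↔ (t : ℕ) < i ∨ (n ≤ (t : ℕ) ∧ (t : ℕ) < n + i) := by
  rw [tauSet, Finset.mem_map_equiv, mem_initialSet]
  change ((if h : (t : ℕ) < n then (⟨2 * t, by omega⟩ : Fin (2 * n))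
    else ⟨2 * (t - n) + 1, by omega⟩ : Fin (2 * n)) : ℕ) < 2 * i ↔ _
  split_ifs <;> simp only <;> omega

theorem mem_initialSet_iff_blockIndex {i : ℕ} (hi : i < n) (a : Fin n) :
    a ∈ initialSet n i ↔ blockIndex n i a ∈ tauSet n i := by
  rw [mem_tauSet hi, mem_initialSet, val_blockIndex]
  split_ifs <;> omega

theorem mem_range_blockIndex {i : ℕ} (hi : i < n) {p : Fin (2 * n)} :
    p ∈ Set.range (blockIndex n i) ↔ i ≤ (p : ℕ) ∧ (p : ℕ) < n + i := by
  constructor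
  · rintro ⟨a, rfl⟩
    rw [val_blockIndex]
    split_ifs <;> omega
  · rintro ⟨hip, hpn⟩
    by_cases h : (p : ℕ) < n
    · exact ⟨⟨p, h⟩, Fin.ext (by rw [val_blockIndex, if_neg hip.not_gt])⟩
    · have hlt : (p : ℕ) - n < i := by omega
      exact ⟨⟨p - n, by omega⟩, Fin.ext (by rw [val_blockIndex, if_pos hlt]; simp only; omega)⟩

theorem blockIndex_lt_of_mem_of_notMem {i : ℕ} {s t : Fin n} (hs : s ∈ initialSet n i)
    (ht : t ∉ initialSet n i) : blockIndex n i t < blockIndex n i s := by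
  rw [mem_initialSet] at hs ht
  rw [Fin.lt_def, val_blockIndex, val_blockIndex, if_pos hs, if_neg ht]
  omega

end TauBlock

section DemazureLattice

variable {n : ℕ} {W : Type*} [AddCommGroup W] [Module ℂ W] [LieRingModule (SlN (2 * n)) W]
  [LieModule ℂ (SlN (2 * n)) W]

variable (W) in
/-- The action of the matrix units of the copy of `𝔤𝔩_n` in `𝔤𝔩_{2n}` with index set
`blockIndex`. -/
def blockUnit (κ : ℂ) (i : ℕ) (a b : Fin n) : Module.End ℂ W :=
  matUnit W κ (blockIndex n i a) (blockIndex n i b)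

theorem isGlRep_blockUnit (κ : ℂ) (i : ℕ) : IsGlRep (blockUnit (n := n) W κ i) :=
  (isGlRep_matUnit κ).reindex (blockIndex_injective i)

variable {κ : ℂ} {i : ℕ} {x : W}

protected theorem IsExtremal.blockUnit {ℓ : ℂ} (hx : IsExtremal (matUnit W κ) (tauSet n i) ℓ x)
    (hi : i < n) : IsExtremal (blockUnit W κ i) (initialSet n i) ℓ x :=
  hx.reindex (blockIndex_injective i) (mem_initialSet_iff_blockIndex hi)

theorem IsExtremal.matUnit_apply_eq_zero_of_mem_lattice {ℓ : ℂ}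
    (hx : IsExtremal (matUnit W κ) (tauSet n i) ℓ x) (hi : i < n) {p q : Fin (2 * n)} (hpq : p ≠ q)
    (h : (p : ℕ) < i ∨ n + i ≤ (q : ℕ)) {d : ℕ} {z : W}
    (hz : z ∈ lattice (blockUnit W κ i) (initialSet n i) x d) :
    matUnit W κ p q z = 0 := by
  have hz := lattice_le_level d hz
  rcases h with hp | hq
  · refine hx.level_reindex_le_ker_of_mem (isGlRep_matUnit κ) hpq ((mem_tauSet hi).2 (.inl hp)) ?_
      d hz
    rw [mem_range_blockIndex hi]
    omega
  · refine hx.level_reindex_le_ker_of_notMem (isGlRep_matUnit κ) hpq ?_ ?_ d hz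
    · rw [mem_tauSet hi]
      omega
    · rw [mem_range_blockIndex hi]
      omega

theorem IsExtremal.divPow_matUnit_mem_iSup_lattice {ℓ : ℂ}
    (hx : IsExtremal (matUnit W κ) (tauSet n i) ℓ x) (hi : i < n) {p q : Fin (2 * n)} (hpq : p < q)
    (m : ℕ) {z : W}
    (hz : z ∈ ⨆ d, lattice (blockUnit W κ i) (initialSet n i) x d) :
    divPow (matUnit W κ p q) m z ∈
      ⨆ d, lattice (blockUnit W κ i) (initialSet n i) x d := by
  suffices (⨆ d, lattice (blockUnit W κ i) (initialSet n i) x d) ≤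
      (⨆ d, lattice (blockUnit W κ i) (initialSet n i) x d).comap
        ((divPow (matUnit W κ p q) m).restrictScalars ℤ) from this hz
  refine iSup_le fun d z hz => ?_
  rw [Submodule.mem_comap, LinearMap.restrictScalars_apply]
  by_cases outside : (p : ℕ) < i ∨ n + i ≤ (q : ℕ)
  · rcases eq_or_ne m 0 with rfl | hm
    · rw [divPow_zero]
      exact Submodule.mem_iSup_of_mem d hz
    · rw [divPow_apply_eq_zero (hx.matUnit_apply_eq_zero_of_mem_lattice hi hpq.ne outside hz) hm]
      exact zero_mem _
  · obtain ⟨a, rfl⟩ := (mem_range_blockIndex (p := p) hi).2 (by omega)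
    obtain ⟨b, rfl⟩ := (mem_range_blockIndex (p := q) hi).2 (by omega)
    by_cases h : a ∈ initialSet n i ↔ b ∈ initialSet n i
    · exact Submodule.mem_iSup_of_mem d <| (hx.blockUnit hi).divPow_levi_mem_lattice
        (isGlRep_blockUnit κ i) (ne_of_apply_ne _ hpq.ne) h m hz
    · have h' : ¬(a ∈ initialSet n i ∧ b ∉ initialSet n i) := fun h =>
        hpq.not_gt (blockIndex_lt_of_mem_of_notMem h.1 h.2)
      exact Submodule.mem_iSup_of_mem (d + m) <|
        divPow_lower_mem_lattice (by tauto) (by tauto) m hz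

theorem IsExtremal.exists_matUnit_self_apply {ℓ : ℤ}
    (hx : IsExtremal (matUnit W κ) (tauSet n i) ℓ x) (p : Fin (2 * n)) {d : ℕ} {z : W}
    (hz : IsMonomial (blockUnit W κ i) (initialSet n i) x d z) :
    ∃ c : ℤ, matUnit W κ p p z = c • z := by
  refine hz.exists_apply_eq_smul
    (fun s _ t _ => ⟨_, (isGlRep_matUnit κ).diag_mul p (blockIndex n i t) (blockIndex n i s)⟩)
    ⟨if p ∈ tauSet n i then ℓ else 0, ?_⟩
  rw [hx.apply_diag, ← Int.cast_smul_eq_zsmul ℂ]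
  split_ifs <;> simp

theorem IsExtremal.binomElt_matUnit_mem_iSup_lattice {ℓ : ℤ}
    (hx : IsExtremal (matUnit W κ) (tauSet n i) ℓ x) (p q : Fin (2 * n)) (m : ℕ) {z : W}
    (hz : z ∈ ⨆ d, lattice (blockUnit W κ i) (initialSet n i) x d) :
    binomElt (matUnit W κ p p - matUnit W κ q q) m z ∈
      ⨆ d, lattice (blockUnit W κ i) (initialSet n i) x d := by
  suffices (⨆ d, lattice (blockUnit W κ i) (initialSet n i) x d) ≤
      (⨆ d, lattice (blockUnit W κ i) (initialSet n i) x d).comap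
        ((binomElt (matUnit W κ p p - matUnit W κ q q) m).restrictScalars ℤ) from this hz
  refine iSup_le fun d => Submodule.span_le.2 fun z hz => ?_
  obtain ⟨c, hc⟩ := hx.exists_matUnit_self_apply p hz
  obtain ⟨c', hc'⟩ := hx.exists_matUnit_self_apply q hz
  have diff_eq : (matUnit W κ p p - matUnit W κ q q) z = (c - c') • z := by
    rw [LinearMap.sub_apply, hc, hc', sub_smul]
  rw [SetLike.mem_coe, Submodule.mem_comap, LinearMap.restrictScalars_apply,
    binomElt_apply diff_eq]
  exact Submodule.smul_mem _ _ (Submodule.mem_iSup_of_mem d (Submodule.subset_span hz))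

theorem lattice_blockUnit_le_demazure (κ : ℂ) (i : ℕ) (g : (Module.End ℂ W)ˣ) (w : W) (d : ℕ) :
    lattice (blockUnit W κ i) (initialSet n i) ((g : Module.End ℂ W) w) d ≤
      demazure (2 * n) g w := by
  refine Submodule.span_le.2 fun z hz => ?_
  induction hz with
  | base => exact mem_demazure g w
  | @lower s t hs ht m _ z _ ih =>
    have hts := blockIndex_lt_of_mem_of_notMem hs ht
    rw [blockUnit, ← uAct_divPow_rootVec κ hts.ne]
    exact demazure_stable g w (Algebra.subset_adjoin (.inl ⟨_, _, hts, m, rfl⟩)) ih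

theorem IsExtremal.demazure_eq_iSup_lattice {ℓ : ℤ} {w : W} {g : (Module.End ℂ W)ˣ}
    (hx : IsExtremal (matUnit W κ) (tauSet n i) ℓ ((g : Module.End ℂ W) w)) (hi : i < n) :
    demazure (2 * n) g w = ⨆ d, lattice (blockUnit W κ i) (initialSet n i)
      ((g : Module.End ℂ W) w) d := by
  refine le_antisymm ?_ (iSup_le (lattice_blockUnit_le_demazure κ i g w))
  rintro _ ⟨u, hu, rfl⟩
  refine uAct_mem_of_mem_hyperBorel (fun p q hpq m z hz => ?_) (fun j hj m z hz => ?_) hu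
    (Submodule.mem_iSup_of_mem 0 mem_lattice_zero)
  · rw [uAct_divPow_rootVec κ]
    exact hx.divPow_matUnit_mem_iSup_lattice hi hpq m hz
  · rw [uAct_binomElt_simpleCoroot κ]
    exact hx.binomElt_matUnit_mem_iSup_lattice _ _ m hz

end DemazureLattice

/-! ### The PBW filtration as a sum of lattices -/

section PBW

variable {n : ℕ} {V : Type*} [AddCommGroup V] [Module ℂ V] [LieRingModule (SlN n) V]
  [LieModule ℂ (SlN n) V]

variable (V) in
/-- The action of the matrix units of `𝔤𝔩_n` twisted by the automorphism `A ↦ -Aᵀ` followed by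
conjugation with the longest Weyl group element, plus `ℓ` times the trace. -/
def twistedUnit (κ ℓ : ℂ) : Fin n → Fin n → Module.End ℂ V :=
  traceShift (contragredient (matUnit V κ) Fin.revPerm) ℓ

theorem isGlRep_twistedUnit (κ ℓ : ℂ) : IsGlRep (twistedUnit (n := n) V κ ℓ) :=
  ((isGlRep_matUnit κ).contragredient _).traceShift _

theorem uAct_divPow_lowVec (κ ℓ : ℂ) (α : PosRoot n) (m : ℕ) :
    uAct V (divPow (lowVec α) m) =
      (-1 : ℤ) ^ m • divPow (twistedUnit V κ ℓ (Fin.rev α.1.1) (Fin.rev α.1.2)) m := by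
  have twistedUnit_rev : twistedUnit V κ ℓ (Fin.rev α.1.1) (Fin.rev α.1.2) =
      -matUnit V κ α.1.2 α.1.1 := by
    rw [twistedUnit, traceShift, if_neg (Fin.rev_injective.ne α.2.ne), contragredient]
    simp
  rw [lowVec, uAct_divPow_rootVec κ, ← divPow_neg, twistedUnit_rev, neg_neg]

variable {κ ℓ : ℂ} {i : ℕ} {v : V}

theorem IsExtremal.uAct_levi_mem_lattice
    (hv : IsExtremal (twistedUnit V κ ℓ) (initialSet n i) ℓ v) {α : PosRoot n}
    (hα : Fin.rev α.1.1 ∈ initialSet n i ↔ Fin.rev α.1.2 ∈ initialSet n i) (m : ℕ) {d : ℕ} {z : V}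
    (hz : z ∈ lattice (twistedUnit V κ ℓ) (initialSet n i) v d) :
    uAct V (divPow (lowVec α) m) z ∈ lattice (twistedUnit V κ ℓ) (initialSet n i) v d := by
  rw [uAct_divPow_lowVec κ ℓ, LinearMap.smul_apply]
  exact Submodule.smul_mem _ _ <| hv.divPow_levi_mem_lattice (isGlRep_twistedUnit κ ℓ)
    (Fin.rev_injective.ne α.2.ne) hα m hz

theorem uAct_lower_mem_lattice {α : PosRoot n} (hs : Fin.rev α.1.2 ∈ initialSet n i)
    (ht : Fin.rev α.1.1 ∉ initialSet n i) (m : ℕ) {d : ℕ} {z : V}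
    (hz : z ∈ lattice (twistedUnit V κ ℓ) (initialSet n i) v d) :
    uAct V (divPow (lowVec α) m) z ∈ lattice (twistedUnit V κ ℓ) (initialSet n i) v (d + m) := by
  rw [uAct_divPow_lowVec κ ℓ, LinearMap.smul_apply]
  exact Submodule.smul_mem _ _ (divPow_lower_mem_lattice hs ht m hz)

theorem mem_initialSet_of_le {s t : Fin n} (hst : s ≤ t) (ht : t ∈ initialSet n i) :
    s ∈ initialSet n i :=
  mem_initialSet.2 <| (Fin.le_def.1 hst).trans_lt (mem_initialSet.1 ht)

theorem IsExtremal.uAct_mem_latticeLE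
    (hv : IsExtremal (twistedUnit V κ ℓ) (initialSet n i) ℓ v) (α : PosRoot n) (m : ℕ) {d : ℤ}
    {z : V} (hz : z ∈ latticeLE (twistedUnit V κ ℓ) (initialSet n i) v d) :
    uAct V (divPow (lowVec α) m) z ∈
      latticeLE (twistedUnit V κ ℓ) (initialSet n i) v (m + d) := by
  suffices latticeLE (twistedUnit V κ ℓ) (initialSet n i) v d ≤
      (latticeLE (twistedUnit V κ ℓ) (initialSet n i) v (m + d)).comap
        ((uAct V (divPow (lowVec α) m)).restrictScalars ℤ) from this hz
  refine iSup₂_le fun e he z hz => ?_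
  rw [Submodule.mem_comap, LinearMap.restrictScalars_apply]
  by_cases hα : Fin.rev α.1.1 ∈ initialSet n i ↔ Fin.rev α.1.2 ∈ initialSet n i
  · exact lattice_le_latticeLE (by omega) (hv.uAct_levi_mem_lattice hα m hz)
  · have hα' := mem_initialSet_of_le (i := i) (Fin.rev_le_rev.2 α.2.le)
    exact lattice_le_latticeLE (by push_cast; omega)
      (uAct_lower_mem_lattice (by tauto) (by tauto) m hz)

theorem IsExtremal.uAct_lowWord_mem_latticeLE
    (hv : IsExtremal (twistedUnit V κ ℓ) (initialSet n i) ℓ v) (l : List (PosRoot n × ℕ)) :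
    uAct V (lowWord l) v ∈
      latticeLE (twistedUnit V κ ℓ) (initialSet n i) v (wordDeg l) := by
  induction l with
  | nil =>
    rw [lowWord, List.map_nil, List.prod_nil, map_one]
    exact lattice_le_latticeLE (Int.natCast_nonneg _) mem_lattice_zero
  | cons r l ih =>
    have lowWord_cons : lowWord (r :: l) = divPow (lowVec r.1) r.2 * lowWord l := List.prod_cons
    have wordDeg_cons : wordDeg (r :: l) = r.2 + wordDeg l := List.sum_cons
    rw [lowWord_cons, wordDeg_cons, map_mul, Module.End.mul_apply, Nat.cast_add]
    exact hv.uAct_mem_latticeLE r.1 r.2 ih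

theorem lattice_twistedUnit_le_pbwFilt (d : ℕ) :
    lattice (twistedUnit V κ ℓ) (initialSet n i) v d ≤ pbwFilt n v d := by
  refine Submodule.span_le.2 fun z hz => ?_
  induction hz with
  | base =>
    exact ⟨1, Submodule.subset_span ⟨[], by simp [wordDeg], by simp [lowWord]⟩, by simp [orbitMap]⟩
  | @lower s t hs ht m d z _ ih =>
    have hst : Fin.rev t < Fin.rev s :=
      Fin.rev_lt_rev.2 (not_le.1 fun h => ht (mem_initialSet_of_le h hs))
    have mem := low_mem v ⟨(Fin.rev t, Fin.rev s), hst⟩ m d ih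
    rw [uAct_divPow_lowVec κ ℓ, LinearMap.smul_apply] at mem
    simp only [Fin.rev_rev] at mem
    have mem_smul := Submodule.smul_mem _ ((-1 : ℤ) ^ m) mem
    rwa [smul_smul, ← mul_pow, neg_one_mul, neg_neg, one_pow, one_smul] at mem_smul

theorem IsExtremal.pbwFilt_eq_latticeLE
    (hv : IsExtremal (twistedUnit V κ ℓ) (initialSet n i) ℓ v) (d : ℤ) :
    pbwFilt n v d = latticeLE (twistedUnit V κ ℓ) (initialSet n i) v d := by
  refine le_antisymm ?_ <| iSup₂_le fun e he =>
    (lattice_twistedUnit_le_pbwFilt e).trans (pbwFilt_mono he)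
  rw [pbwFilt, pbw, Submodule.map_span, Submodule.span_le]
  rintro _ ⟨_, ⟨l, hl, rfl⟩, rfl⟩
  exact iSup₂_le (fun e he => lattice_le_latticeLE (he.trans hl)) (hv.uAct_lowWord_mem_latticeLE l)

end PBW

/-! ### The isomorphism -/

section SumsAndQuotients

variable {R M : Type*} [Ring R] [AddCommGroup M] [Module R M]

/-- The internal direct sum of an independent family of submodules, as a submodule. -/
def directSumEquivISup {ι : Type*} [DecidableEq ι] {p : ι → Submodule R M} (h : iSupIndep p) :
    DirectSum ι (fun j => p j) ≃ₗ[R] ↥(⨆ j, p j) :=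
  .ofInjective (DirectSum.coeLinearMap p) h.dfinsupp_lsum_injective ≪≫ₗ
    .ofEq _ _ (Submodule.iSup_eq_range_dfinsupp_lsum p).symm

theorem coe_directSumEquivISup_lof {ι : Type*} [DecidableEq ι] {p : ι → Submodule R M}
    (h : iSupIndep p) (j : ι) (z : p j) :
    (directSumEquivISup h (DirectSum.lof R ι _ j z) : M) = z :=
  DirectSum.coeLinearMap_lof p j z

/-- A complement `L` of a submodule `G` inside `F` is isomorphic to the quotient `F ⧸ G`. -/
def complementEquivQuotient {L F G : Submodule R M} (hL : L ≤ F) (hF : F ≤ L ⊔ G)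
    (hLG : Disjoint L G) : L ≃ₗ[R] F ⧸ G.submoduleOf F :=
  .ofBijective ((G.submoduleOf F).mkQ ∘ₗ Submodule.inclusion hL) <| by
    refine ⟨(injective_iff_map_eq_zero _).2 fun z hz => Subtype.ext ?_, fun q => ?_⟩
    · have hG : (z : M) ∈ G := (Submodule.Quotient.mk_eq_zero (G.submoduleOf F)).1 hz
      exact Submodule.disjoint_def.1 hLG z z.2 hG
    · obtain ⟨⟨y, hy⟩, rfl⟩ := Submodule.Quotient.mk_surjective _ q
      obtain ⟨a, ha, b, hb, rfl⟩ := Submodule.mem_sup.1 (hF hy)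
      refine ⟨⟨a, ha⟩, (Submodule.Quotient.eq _).2 ?_⟩
      change a - (a + b) ∈ G
      rw [sub_add_cancel_left]
      exact neg_mem hb

end SumsAndQuotients

theorem SymZ.closure_range_gen (n : ℕ) :
    Subring.closure (Set.range fun r : PosRoot n × ℕ => SymZ.gen r.1 r.2) = ⊤ := by
  let C := Subring.closure (Set.range fun r : PosRoot n × ℕ => SymZ.gen r.1 r.2)
  let toClosure : SymZ n →+* C :=
    SymZ.lift (fun α m => ⟨SymZ.gen α m, Subring.subset_closure ⟨(α, m), rfl⟩⟩)
      (fun α => Subtype.ext (SymZ.gen_zero α)) (fun α a b => Subtype.ext (SymZ.gen_mul α a b))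
      (fun α β a b => Subtype.ext (SymZ.gen_comm α β a b))
  have subtype_comp : C.subtype.comp toClosure = RingHom.id (SymZ n) :=
    SymZ.hom_ext fun α m => congrArg Subtype.val (SymZ.lift_gen _ _ _ _ α m)
  refine (Subring.eq_top_iff' C).2 fun s => ?_
  have coe_toClosure : (toClosure s : SymZ n) = s := DFunLike.congr_fun subtype_comp s
  exact coe_toClosure ▸ (toClosure s).2

theorem SymZ.map_smul_of_map_gen_smul {n : ℕ} {R M N : Type*} [Ring R] [AddCommGroup M]
    [Module (SymZ n) M] [AddCommGroup N] [Module R N] {σ : SymZ n →+* R} {f : M →+ N}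
    (h : ∀ α m z, f (SymZ.gen α m • z) = σ (SymZ.gen α m) • f z) (s : SymZ n) (z : M) :
    f (s • z) = σ s • f z := by
  have hs : s ∈ Subring.closure (Set.range fun r : PosRoot n × ℕ => SymZ.gen r.1 r.2) :=
    SymZ.closure_range_gen n ▸ Subring.mem_top s
  induction hs using Subring.closure_induction generalizing z with
  | mem s hs =>
    obtain ⟨⟨α, m⟩, rfl⟩ := hs
    exact h α m z
  | zero => simp only [zero_smul, map_zero]
  | one => simp only [one_smul, map_one]
  | add s t _ _ hs ht => simp only [add_smul, map_add, hs, ht]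
  | neg s _ hs => simp only [neg_smul, map_neg, hs]
  | mul s t _ _ hs ht => simp only [mul_smul, map_mul, hs, ht]

section DemazureSide

variable {n : ℕ} {W : Type*} [AddCommGroup W] [Module ℂ W] [LieRingModule (SlN (2 * n)) W]
  [LieModule ℂ (SlN (2 * n)) W] {κ : ℂ} {ℓ : ℤ} {i : ℕ} {w : W} {g : (Module.End ℂ W)ˣ}

theorem uAct_divPow_abelVec (κ : ℂ) {α : PosRoot n} (hs : α.1.1 ∈ initialSet n i)
    (ht : α.1.2 ∉ initialSet n i) (m : ℕ) :
    uAct W (divPow (abelVec α) m) = divPow (blockUnit W κ i α.1.2 α.1.1) m := by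
  rw [mem_initialSet] at hs ht
  rw [abelVec, uAct_divPow_rootVec κ, blockUnit, blockIndex, blockIndex, if_neg ht, if_pos hs]

theorem IsExtremal.uAct_abelVec_eq_zero {x : W}
    (hx : IsExtremal (matUnit W κ) (tauSet n i) ℓ x) (hi : i < n) {α : PosRoot n}
    (hα : ¬(α.1.1 ∈ initialSet n i ∧ α.1.2 ∉ initialSet n i)) {m : ℕ} (hm : m ≠ 0) {d : ℕ} {z : W}
    (hz : z ∈ lattice (blockUnit W κ i) (initialSet n i) x d) :
    uAct W (divPow (abelVec α) m) z = 0 := by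
  rw [mem_initialSet, mem_initialSet] at hα
  rw [abelVec, uAct_divPow_rootVec κ]
  refine divPow_apply_eq_zero (hx.matUnit_apply_eq_zero_of_mem_lattice hi ?_ ?_ hz) hm
  · exact Fin.ne_of_val_ne (by simp only; omega)
  · simp only
    omega

/-- The decomposition of the Demazure module by degree. -/
def demazureEquiv (hx : IsExtremal (matUnit W κ) (tauSet n i) ℓ ((g : Module.End ℂ W) w))
    (hi : i < n) :
    DirectSum ℕ (fun d => lattice (blockUnit W κ i) (initialSet n i) ((g : Module.End ℂ W) w) d)
      ≃ₗ[ℤ] demazure (2 * n) g w :=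
  directSumEquivISup ((hx.blockUnit hi).iSupIndep_lattice (isGlRep_blockUnit κ i)) ≪≫ₗ
    .ofEq _ _ (hx.demazure_eq_iSup_lattice hi).symm

theorem coe_demazureEquiv_lof
    (hx : IsExtremal (matUnit W κ) (tauSet n i) ℓ ((g : Module.End ℂ W) w)) (hi : i < n) (d : ℕ)
    (z : lattice (blockUnit W κ i) (initialSet n i) ((g : Module.End ℂ W) w) d) :
    (demazureEquiv hx hi (DirectSum.lof ℤ ℕ _ d z) : W) = z :=
  coe_directSumEquivISup_lof ((hx.blockUnit hi).iSupIndep_lattice (isGlRep_blockUnit κ i)) d z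

theorem gen_smul_demazureEquiv_lof
    (hx : IsExtremal (matUnit W κ) (tauSet n i) ℓ ((g : Module.End ℂ W) w)) (hi : i < n)
    {α : PosRoot n} (hs : α.1.1 ∈ initialSet n i) (ht : α.1.2 ∉ initialSet n i) (m d : ℕ)
    (z : lattice (blockUnit W κ i) (initialSet n i) ((g : Module.End ℂ W) w) d) :
    SymZ.gen α m • demazureEquiv hx hi (DirectSum.lof ℤ ℕ _ d z) =
      demazureEquiv hx hi (DirectSum.lof ℤ ℕ _ (d + m)
        ⟨divPow (blockUnit W κ i α.1.2 α.1.1) m z, divPow_lower_mem_lattice hs ht m z.2⟩) := by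
  ext
  rw [gen_smul_demazure, coe_demazureEquiv_lof, coe_demazureEquiv_lof, uAct_divPow_abelVec κ hs ht]

theorem gen_smul_demazureEquiv_lof_eq_zero
    (hx : IsExtremal (matUnit W κ) (tauSet n i) ℓ ((g : Module.End ℂ W) w)) (hi : i < n)
    {α : PosRoot n} (hα : ¬(α.1.1 ∈ initialSet n i ∧ α.1.2 ∉ initialSet n i)) {m : ℕ} (hm : m ≠ 0)
    (d : ℕ) (z : lattice (blockUnit W κ i) (initialSet n i) ((g : Module.End ℂ W) w) d) :
    SymZ.gen α m • demazureEquiv hx hi (DirectSum.lof ℤ ℕ _ d z) = 0 := by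
  ext
  rw [gen_smul_demazure, coe_demazureEquiv_lof, hx.uAct_abelVec_eq_zero hi hα hm z.2,
    ZeroMemClass.coe_zero]

end DemazureSide

theorem mem_initialSet_iff_revPerm_notMem {n : ℕ} (i : Set.Ioo 0 n) (a : Fin n) :
    a ∈ initialSet n i ↔ Fin.revPerm a ∉ initialSet n (dualIndex i : Set.Ioo 0 n) := by
  have hi := i.2
  rw [mem_initialSet, mem_initialSet, Fin.revPerm_apply, Fin.val_rev, dualIndex]
  simp only [Set.mem_Ioo] at hi ⊢
  omega

section AbelianizedSide

variable {n : ℕ} {V : Type*} [AddCommGroup V] [Module ℂ V] [LieRingModule (SlN n) V]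
  [LieModule ℂ (SlN n) V] {κ : ℂ} {ℓ : ℤ} {i : ℕ} {v : V}

theorem grClass_eq_zero {s : ℕ} {y : V} (hy : y ∈ pbwFilt n v s)
    (hy' : y ∈ pbwFilt n v ((s : ℤ) - 1)) : grClass v s y hy = 0 :=
  (congrArg (DirectSum.lof ℤ ℕ (grPiece n v) s)
    ((Submodule.Quotient.mk_eq_zero _).2 (Submodule.mem_comap.2 hy'))).trans (map_zero _)

theorem zsmul_grClass (c : ℤ) (s : ℕ) (y : V) (hy : y ∈ pbwFilt n v s) :
    c • grClass v s y hy = grClass v s (c • y) (zsmul_mem hy c) := by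
  exact (map_zsmul (DirectSum.lof ℤ ℕ (grPiece n v) s) c (Submodule.Quotient.mk ⟨y, hy⟩)).symm

theorem chevalleyTwist_gen_smul_grClass (α : PosRoot n) (m s : ℕ) (y : V)
    (hy : y ∈ pbwFilt n v s) :
    chevalleyTwist n (SymZ.gen α m) • grClass v s y hy =
      (-1 : ℤ) ^ m • grClass v (s + m) (uAct V (divPow (lowVec (dualRoot α)) m) y)
        (low_mem v (dualRoot α) m s hy) := by
  have coe_neg_one_pow : (-1 : SymZ n) ^ m = (((-1) ^ m : ℤ) : SymZ n) := by push_cast; rfl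
  rw [chevalleyTwist_gen, mul_smul, gen_smul_grClass, coe_neg_one_pow, Int.cast_smul_eq_zsmul]

theorem uAct_divPow_lowVec_dualRoot (κ ℓ : ℂ) (α : PosRoot n) (m : ℕ) :
    uAct V (divPow (lowVec (dualRoot α)) m) =
      (-1 : ℤ) ^ m • divPow (twistedUnit V κ ℓ α.1.2 α.1.1) m := by
  rw [uAct_divPow_lowVec κ ℓ]
  simp only [dualRoot, Fin.rev_rev]

/-- The lattice of degree `d` represents the homogeneous component of degree `d` of the abelianized
module. -/
def grPieceEquiv (hv : IsExtremal (twistedUnit V κ ℓ) (initialSet n i) ℓ v) (d : ℕ) :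
    lattice (twistedUnit V κ ℓ) (initialSet n i) v d ≃ₗ[ℤ] grPiece n v d :=
  complementEquivQuotient (lattice_twistedUnit_le_pbwFilt d)
    (by simpa only [hv.pbwFilt_eq_latticeLE] using latticeLE_le_sup d)
    (by
      rw [hv.pbwFilt_eq_latticeLE]
      exact hv.disjoint_lattice_latticeLE (isGlRep_twistedUnit κ ℓ) (sub_one_lt _))

/-- The decomposition of the abelianized module by degree. -/
def abelianizedEquiv (hv : IsExtremal (twistedUnit V κ ℓ) (initialSet n i) ℓ v) :
    DirectSum ℕ (fun d => lattice (twistedUnit V κ ℓ) (initialSet n i) v d) ≃ₗ[ℤ]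
      Abelianized n v :=
  DirectSum.congrLinearEquiv (grPieceEquiv hv)

theorem abelianizedEquiv_lof (hv : IsExtremal (twistedUnit V κ ℓ) (initialSet n i) ℓ v) (d : ℕ)
    (z : lattice (twistedUnit V κ ℓ) (initialSet n i) v d) :
    abelianizedEquiv hv (DirectSum.lof ℤ ℕ _ d z) =
      grClass v d z (lattice_twistedUnit_le_pbwFilt d z.2) :=
  DirectSum.lmap_lof (fun d => (grPieceEquiv hv d).toLinearMap) d z

theorem chevalleyTwist_gen_smul_abelianizedEquiv_lof
    (hv : IsExtremal (twistedUnit V κ ℓ) (initialSet n i) ℓ v) {α : PosRoot n}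
    (hs : α.1.1 ∈ initialSet n i) (ht : α.1.2 ∉ initialSet n i) (m d : ℕ)
    (z : lattice (twistedUnit V κ ℓ) (initialSet n i) v d) :
    chevalleyTwist n (SymZ.gen α m) • abelianizedEquiv hv (DirectSum.lof ℤ ℕ _ d z) =
      abelianizedEquiv hv (DirectSum.lof ℤ ℕ _ (d + m)
        ⟨divPow (twistedUnit V κ ℓ α.1.2 α.1.1) m z, divPow_lower_mem_lattice hs ht m z.2⟩) := by
  rw [abelianizedEquiv_lof, abelianizedEquiv_lof, chevalleyTwist_gen_smul_grClass, zsmul_grClass]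
  congr 1
  rw [uAct_divPow_lowVec_dualRoot κ ℓ, LinearMap.smul_apply, smul_smul, ← mul_pow, neg_one_mul,
    neg_neg, one_pow, one_smul]

theorem chevalleyTwist_gen_smul_abelianizedEquiv_lof_eq_zero
    (hv : IsExtremal (twistedUnit V κ ℓ) (initialSet n i) ℓ v) {α : PosRoot n}
    (hα : ¬(α.1.1 ∈ initialSet n i ∧ α.1.2 ∉ initialSet n i)) {m : ℕ} (hm : m ≠ 0) (d : ℕ)
    (z : lattice (twistedUnit V κ ℓ) (initialSet n i) v d) :
    chevalleyTwist n (SymZ.gen α m) • abelianizedEquiv hv (DirectSum.lof ℤ ℕ _ d z) = 0 := by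
  have levi : Fin.rev (dualRoot α).1.1 ∈ initialSet n i ↔
      Fin.rev (dualRoot α).1.2 ∈ initialSet n i := by
    have := mem_initialSet_of_le (i := i) α.2.le
    simp only [dualRoot, Fin.rev_rev]
    tauto
  rw [abelianizedEquiv_lof, chevalleyTwist_gen_smul_grClass, grClass_eq_zero, smul_zero]
  rw [hv.pbwFilt_eq_latticeLE]
  exact lattice_le_latticeLE (by push_cast; omega) (hv.uAct_levi_mem_lattice levi m z.2)

end AbelianizedSide

section Isomorphism

variable {n i : ℕ} {W V : Type*} [AddCommGroup W] [Module ℂ W] [LieRingModule (SlN (2 * n)) W]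
  [LieModule ℂ (SlN (2 * n)) W] [AddCommGroup V] [Module ℂ V] [LieRingModule (SlN n) V]
  [LieModule ℂ (SlN n) V] {κ κ' : ℂ} {ℓ : ℤ} {w : W} {g : (Module.End ℂ W)ˣ} {v : V}

/-- The additive isomorphism of the Demazure module with the abelianized module induced by
isomorphisms of their lattices in each degree. -/
def demazureEquivAbelianized
    (hx : IsExtremal (matUnit W κ) (tauSet n i) ℓ ((g : Module.End ℂ W) w)) (hi : i < n)
    (hv : IsExtremal (twistedUnit V κ' ℓ) (initialSet n i) ℓ v)
    (e : ∀ d, lattice (blockUnit W κ i) (initialSet n i) ((g : Module.End ℂ W) w) d ≃ₗ[ℤ]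
      lattice (twistedUnit V κ' ℓ) (initialSet n i) v d) :
    demazure (2 * n) g w ≃ₗ[ℤ] Abelianized n v :=
  (demazureEquiv hx hi).symm ≪≫ₗ DirectSum.congrLinearEquiv e ≪≫ₗ abelianizedEquiv hv

section

variable (hx : IsExtremal (matUnit W κ) (tauSet n i) ℓ ((g : Module.End ℂ W) w)) (hi : i < n)
  (hv : IsExtremal (twistedUnit V κ' ℓ) (initialSet n i) ℓ v)
  (e : ∀ d, lattice (blockUnit W κ i) (initialSet n i) ((g : Module.End ℂ W) w) d ≃ₗ[ℤ]
    lattice (twistedUnit V κ' ℓ) (initialSet n i) v d)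

theorem demazureEquivAbelianized_lof (d : ℕ)
    (z : lattice (blockUnit W κ i) (initialSet n i) ((g : Module.End ℂ W) w) d) :
    demazureEquivAbelianized hx hi hv e (demazureEquiv hx hi (DirectSum.lof ℤ ℕ _ d z)) =
      abelianizedEquiv hv (DirectSum.lof ℤ ℕ _ d (e d z)) := by
  simp only [demazureEquivAbelianized, LinearEquiv.trans_apply, LinearEquiv.symm_apply_apply]
  exact congrArg _ (DirectSum.lmap_lof (fun d => (e d).toLinearMap) d z)

theorem demazureEquivAbelianized_gen_smul
    (he : ∀ {s t} (hs : s ∈ initialSet n i) (ht : t ∉ initialSet n i) m d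
      (z : lattice (blockUnit W κ i) (initialSet n i) ((g : Module.End ℂ W) w) d),
      (e (d + m) ⟨divPow (blockUnit W κ i t s) m z, divPow_lower_mem_lattice hs ht m z.2⟩ : V) =
        divPow (twistedUnit V κ' ℓ t s) m (e d z))
    (α : PosRoot n) (m : ℕ) (z : demazure (2 * n) g w) :
    demazureEquivAbelianized hx hi hv e (SymZ.gen α m • z) =
      chevalleyTwist n (SymZ.gen α m) • demazureEquivAbelianized hx hi hv e z := by
  rcases eq_or_ne m 0 with rfl | hm
  · rw [SymZ.gen_zero, map_one, one_smul, one_smul]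
  obtain ⟨z, rfl⟩ := (demazureEquiv hx hi).surjective z
  induction z using DirectSum.induction_on with
  | zero => simp only [map_zero, smul_zero]
  | add z z' hz hz' => simp only [map_add, smul_add, hz, hz']
  | of d z =>
    rw [← DirectSum.lof_eq_of ℤ, demazureEquivAbelianized_lof]
    by_cases hα : α.1.1 ∈ initialSet n i ∧ α.1.2 ∉ initialSet n i
    · rw [gen_smul_demazureEquiv_lof hx hi hα.1 hα.2, demazureEquivAbelianized_lof,
        chevalleyTwist_gen_smul_abelianizedEquiv_lof hv hα.1 hα.2]
      exact congrArg _ (congrArg _ (Subtype.ext (he hα.1 hα.2 m d z)))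
    · rw [gen_smul_demazureEquiv_lof_eq_zero hx hi hα hm, map_zero,
        chevalleyTwist_gen_smul_abelianizedEquiv_lof_eq_zero hv hα hm]

end

theorem nonempty_demazure_equiv_abelianized [LieModule.IsIrreducible ℂ (SlN (2 * n)) W]
    [LieModule.IsIrreducible ℂ (SlN n) V]
    (hx : IsExtremal (matUnit W κ) (tauSet n i) ℓ ((g : Module.End ℂ W) w)) (hi : i < n)
    (hv : IsExtremal (twistedUnit V κ' ℓ) (initialSet n i) ℓ v) :
    Nonempty (demazure (2 * n) g w ≃ₛₗ[chevalleyTwist n] Abelianized n v) := by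
  have nondegenerate_w := hx.isNondegenerate_reindex (isGlRep_matUnit κ)
    (hx.isNondegenerate (isGlRep_matUnit κ) (isSimpleFamily_matUnit κ))
    (mem_initialSet_iff_blockIndex hi)
  have nondegenerate_v := hv.isNondegenerate (isGlRep_twistedUnit κ' ℓ)
    (((isSimpleFamily_matUnit κ').contragredient _).traceShift _)
  obtain ⟨e, he⟩ := exists_latticeEquiv (isGlRep_blockUnit κ i) (isGlRep_twistedUnit κ' ℓ)
    (hx.blockUnit hi) hv nondegenerate_w nondegenerate_v
  let Φ := (demazureEquivAbelianized hx hi hv e).toAddEquiv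
  exact ⟨{ Φ with
    map_smul' := SymZ.map_smul_of_map_gen_smul (f := Φ.toAddMonoidHom)
      (demazureEquivAbelianized_gen_smul hx hi hv e he) }⟩

end Isomorphism

end AbelianizedDemazure

end

theorem mainTheorem9 (n : ℕ) (i : Set.Ioo 0 n) (ℓ : ℕ)
    {W : Type*} [AddCommGroup W] [Module ℂ W] [LieRingModule (SlN (2 * n)) W]
    [LieModule ℂ (SlN (2 * n)) W] [FiniteDimensional ℂ W] [LieModule.IsIrreducible ℂ (SlN (2 * n)) W]
    (w : W) (hw : IsHighestWeightVector (Psi (Pi.single i (ℓ : ℤ))) w)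
    (g : (Module.End ℂ W)ˣ) (hg : IsWeylRepresentative (tau n) g)
    {V : Type*} [AddCommGroup V] [Module ℂ V] [LieRingModule (SlN n) V]
    [LieModule ℂ (SlN n) V] [FiniteDimensional ℂ V] [LieModule.IsIrreducible ℂ (SlN n) V]
    (v : V) (hv : IsHighestWeightVector (Pi.single (dualIndex i) (ℓ : ℤ)) v) :
    Nonempty (demazure (2 * n) g w ≃ₛₗ[chevalleyTwist n] Abelianized n v) := by
  rw [Psi_single] at hw
  have extremal_w := hw.isExtremal.map_perm (isGlRep_matUnit _) (isSimpleFamily_matUnit _)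
    (hg.mul_matUnit _)
  have extremal_v := hv.isExtremal.contragredient (mem_initialSet_iff_revPerm_notMem i)
  exact nonempty_demazure_equiv_abelianized extremal_w i.2.2 extremal_v
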